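/- For positive integers $d,n$ and a real $r>0$, let $G_d(n,r)$ be the random geometric graph on vertex set $\{1,\dots,n\}$ obtained from independent uniform random points $X_1,\dots,X_n$ in $[0,1]^d$ by joining distinct $i,j$ whenever $\lVert X_i-X_j\rVert\le r$, where $\lVert\cdot\rVert$ is the Euclidean norm. For a graph $G$ and $\alpha\in[0,1]$, an $\alpha$-subgraph of $G$ is a spanning subgraph $H\subseteq G$ with $d_H(v)\ge\alpha\, d_G(v)$ for every vertex $v$ of $G$. A property holds a.a.s. if its probability tends to $1$ as $n\to\infty$; $r=r(n)$ may depend on $n$, and $\log$ is the natural logarithm. The following statements hold. (i) For every $\epsilon\in(0,1/2]$ and every $r=r(n)>0$ with $r\le \dfrac{\log n}{4\epsilon n}$ (for all sufficiently large $n$), a.a.s. there exists a disconnected $(1/2+\epsilon)$-subgraph of $G_1(n,r)$. (ii) For every $C>0$ there exists $\epsilon=\epsilon(C)\in(0,1/2]$ such that, for every $r=r(n)>0$ with $r\le C\left(\dfrac{\log n}{n}\right)^{1/2}$ (for all sufficiently large $n$), a.a.s. there exists a disconnected $(1/2+\epsilon)$-subgraph of $G_2(n,r)$. -/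

import Mathlib

open MeasureTheory Filter Topology

namespace RGG

/-- The unit cube `[0,1]^d` in Euclidean space. -/
def unitCube (d : ℕ) : Set (EuclideanSpace ℝ (Fin d)) :=
  {x | ∀ i, x i ∈ Set.Icc (0 : ℝ) 1}

/-- The uniform distribution on `[0,1]^d`: Lebesgue measure restricted to the cube
(which has volume `1`). -/
noncomputable def cubeUniform (d : ℕ) : Measure (EuclideanSpace ℝ (Fin d)) :=
  volume.restrict (unitCube d)

theorem volume_unitCube (d : ℕ) : volume (unitCube d) = 1 := by
  have h : unitCube d =
      (MeasurableEquiv.toLp 2 (Fin d → ℝ)).symm ⁻¹'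
        (Set.univ.pi fun _ => Set.Icc (0 : ℝ) 1) := by
    ext x
    simp [unitCube, Pi.le_def, forall_and]
  rw [h, (EuclideanSpace.volume_preserving_symm_measurableEquiv_toLp
    (Fin d)).measure_preimage_equiv, volume_pi_pi]
  simp

instance (d : ℕ) : IsProbabilityMeasure (cubeUniform d) :=
  ⟨by rw [cubeUniform, Measure.restrict_apply_univ, volume_unitCube]⟩

/-- The joint law of `n` independent uniform random points of `[0,1]^d`. -/
noncomputable def pointsLaw (d n : ℕ) : Measure (Fin n → EuclideanSpace ℝ (Fin d)) :=
  Measure.pi fun _ => cubeUniform d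

instance (d n : ℕ) : IsProbabilityMeasure (pointsLaw d n) := by
  unfold pointsLaw; infer_instance

/-- The geometric graph of the points `X` with radius `r`: distinct `i`, `j` are adjacent
iff the Euclidean distance of `X i` and `X j` is at most `r`. -/
def geomGraph {d n : ℕ} (X : Fin n → EuclideanSpace ℝ (Fin d)) (r : ℝ) :
    SimpleGraph (Fin n) where
  Adj i j := i ≠ j ∧ dist (X i) (X j) ≤ r
  symm := ⟨fun i j h => ⟨h.1.symm, by rw [dist_comm]; exact h.2⟩⟩
  loopless := ⟨fun _ h => h.1 rfl⟩

open Classical in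
/-- `H` is an `α`-subgraph of `G`: a (spanning) subgraph with
`d_H(v) ≥ α d_G(v)` for every vertex `v`. -/
def IsAlphaSubgraph {V : Type*} [Fintype V] (α : ℝ) (H G : SimpleGraph V) : Prop :=
  H ≤ G ∧ ∀ v, α * (G.degree v : ℝ) ≤ (H.degree v : ℝ)

/-- Asymptotically almost surely the random geometric graph `G_d(n, r(n))` satisfies `P`:
the probability tends to `1` as `n → ∞`. -/
def AAS (d : ℕ) (r : ℕ → ℝ) (P : ∀ n : ℕ, SimpleGraph (Fin n) → Prop) : Prop :=
  Tendsto (fun n => pointsLaw d n {X | P n (geomGraph X (r n))}) atTop (𝓝 1)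

end RGG

namespace RGG

set_option linter.unusedSectionVars false

/-! Deleting all edges between a region `A` and its complement disconnects the graph once both sides
contain points. The result is a `(1/2 + ε)`-subgraph if every vertex keeps that share of its
neighbours on its own side. Typical configurations need not allow this, but a rare local fluctuation
does, and somewhere in the cube it occurs.

Measure lengths in units of `r` and use cells of side `η`, so that a cell expects `a = η^d * (n *
r^d)` points. When `n * r^d` is of order `log n`, a bounded window shows exactly `⌊l c * a⌋` points
in each cell `c` with probability at least `exp (-a * ∑ c, (l c - 1)^2)` up to a power of `log n`.
Of the order of `n / log n` disjoint windows fit into the cube. Hence, if `a * ∑ c, (l c - 1)^2 ≤ (1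
- δ) * log n`, a second moment argument finds the profile `l` a.a.s. (`real_no_window_le`,
`tendsto_hasPattern`). It remains to design cheap profiles that separate two sides (`IsCut`);
`exists_disconnected_of_hasPattern` turns them into subgraphs.

On the line the profile is an empty gap of length `x`. A vertex at its edge sees length `1` on its
own side and `1 - x` across, which suffices when `x > 4ε / (1 + 2ε)`. The cost `x * n * r ≤ x * log
n / (4ε)` is affordable when `x < 4ε` (`isCut_line`, `aas_line`).

In the plane the cut is a circle of large radius `R`: an annulus of width `h = 1 / R^2` is empty,
and curvature is compensated by a density `ρ` in a collar inside the circle. Let `I`, `O` be the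
areas of the parts of a unit disc inside radius `R` and outside radius `R + h` when its centre has
norm `R`, and `I'`, `O'` the same at norm `R + h`. Then `I' ≤ I` and `O < O'`, so any `ρ` strictly
between `O / I` and `O' / I'` gives both sides a majority (`exists_balancing_density`). As `|ρ - 1|
= O(1 / R)` on a collar of area `O(R)`, the cost is `O(1 / R)` (`cost_disc_le`), and `R` of order
`C^2` makes it affordable.

Radii for which `n * r^d` is too small for this are handled by monotonicity: a graph that is
disconnected at a larger reference radius is disconnected at `r` (`aas_of_aas_max`). -/

/-- The maps `Fin n → Option ι` taking each value `some c` exactly `k c` times. -/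
def labelings {ι : Type*} [Fintype ι] [DecidableEq ι] (n : ℕ) (k : ι → ℕ) :
    Finset (Fin n → Option ι) :=
  Finset.univ.filter fun f => ∀ c, (Finset.univ.filter fun i => f i = some c).card = k c

/-! ### Multinomial counting. -/

section Labelings

variable {ι : Type*} [Fintype ι] [DecidableEq ι] {n : ℕ} {k : ι → ℕ}

lemma mem_labelings {f : Fin n → Option ι} :
    f ∈ labelings n k ↔ ∀ c, (Finset.univ.filter fun i => f i = some c).card = k c := by
  simp [labelings]

lemma sum_card_fibers {f : Fin n → Option ι} (hf : f ∈ labelings n k) :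
    (Finset.univ.filter fun i => f i = none).card + ∑ c, k c = n := by
  have h := Finset.card_eq_sum_card_fiberwise (s := (Finset.univ : Finset (Fin n)))
    (t := (Finset.univ : Finset (Option ι))) (f := f) (by simp)
  rw [Fintype.sum_option] at h
  simp only [Finset.card_univ, Fintype.card_fin] at h
  rw [mem_labelings] at hf
  simp only [hf] at h
  exact h.symm

lemma exists_mem_labelings (hk : ∑ c, k c ≤ n) : ∃ f, f ∈ labelings n k := by
  let k' : Option ι → ℕ := fun o => o.elim (n - ∑ c, k c) k
  have hcard : Fintype.card (Σ o : Option ι, Fin (k' o)) = Fintype.card (Fin n) := by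
    simp [k', Fintype.sum_option]
    omega
  let e := Fintype.equivOfCardEq hcard
  refine ⟨fun i => (e.symm i).1, mem_labelings.2 fun c => ?_⟩
  have hinj : Function.Injective fun t : Fin (k' (some c)) => e ⟨some c, t⟩ := by
    intro s t hst
    simpa using hst
  have : (Finset.univ.filter fun i => (e.symm i).1 = some c)
      = (Finset.univ : Finset (Fin (k' (some c)))).image fun t => e ⟨some c, t⟩ := by
    ext i
    simp only [Finset.mem_filter, Finset.mem_univ, true_and, Finset.mem_image]
    constructor
    · intro h
      obtain ⟨x, rfl⟩ := e.surjective i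
      obtain ⟨o, t⟩ := x
      simp only [Equiv.symm_apply_apply] at h
      subst h
      exact ⟨t, rfl⟩
    · rintro ⟨t, rfl⟩
      simp
  rw [this, Finset.card_image_of_injective _ hinj, Finset.card_univ, Fintype.card_fin]
  rfl

/-- Orbit counting: permutations act on a labeling `f` by precomposition, and each fibre of `g ↦ f ∘
g` injects into the stabiliser of `f`, a product of symmetric groups. Only this lower half of the
multinomial formula is needed. -/
lemma factorial_le_card_labelings (hk : ∑ c, k c ≤ n) :
    n.factorial ≤ ((n - ∑ c, k c).factorial * ∏ c, (k c).factorial) * (labelings n k).card := by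
  obtain ⟨f, hf⟩ := exists_mem_labelings hk
  have hstab : Fintype.card {g : Equiv.Perm (Fin n) // f ∘ g = f}
      = (n - ∑ c, k c).factorial * ∏ c, (k c).factorial := by
    rw [DomMulAct.stabilizer_card, Fintype.prod_option]
    have h1 := sum_card_fibers hf
    have h2 := mem_labelings.1 hf
    simp only [Fintype.card_subtype]
    simp only [h2]
    congr 2
    omega
  have hn : n.factorial = (Finset.univ : Finset (Equiv.Perm (Fin n))).card := by
    rw [Finset.card_univ, Fintype.card_perm, Fintype.card_fin]
  rw [hn, ← hstab]
  refine Finset.card_le_mul_card_image_of_maps_to (f := fun g : Equiv.Perm (Fin n) => f ∘ g)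
    ?_ _ ?_
  · intro g _
    refine mem_labelings.2 fun c => ?_
    rw [← mem_labelings.1 hf c]
    refine Finset.card_bij (fun i _ => g i) (by simp) (by simp) ?_
    intro b hb
    exact ⟨g.symm b, by simpa using hb, by simp⟩
  · intro h _
    by_cases hne : ∃ g₀ : Equiv.Perm (Fin n), f ∘ g₀ = h
    · obtain ⟨g₀, rfl⟩ := hne
      rw [Fintype.card_subtype]
      refine Finset.card_le_card_of_injOn (fun g => g * g₀⁻¹) ?_ ?_
      · intro g hg
        simp only [Finset.coe_filter, Finset.mem_univ, true_and, Set.mem_ofPred_eq] at hg ⊢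
        funext i
        have := congrFun hg (g₀⁻¹ i)
        simpa using this
      · intro a _ b _ hab
        simpa using hab
    · push Not at hne
      rw [Finset.filter_eq_empty_iff.2 (fun g _ => hne g)]
      simp

end Labelings

/-! ### Numbers of independent points in disjoint cells. -/

section Counts

variable {Ω : Type*} {ι : Type*} {n : ℕ}

/-- The part of the partition of `Ω` generated by the sets `Q c` that carries a given label. -/
def block (Q : ι → Set Ω) : Option ι → Set Ω
  | some c => Q c
  | none => (⋃ c, Q c)ᶜ

/-- The event that each set `Q c` contains exactly `k c` of the points. -/
def countEvent (n : ℕ) (Q : ι → Set Ω) (k : ι → ℕ) : Set (Fin n → Ω) :=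
  {X | ∀ c, {i | X i ∈ Q c}.ncard = k c}

lemma exists_mem_block (Q : ι → Set Ω) (x : Ω) : ∃ o, x ∈ block Q o := by
  by_cases h : ∃ c, x ∈ Q c
  · obtain ⟨c, hc⟩ := h
    exact ⟨some c, hc⟩
  · exact ⟨none, by simpa [block] using h⟩

lemma block_disjoint {Q : ι → Set Ω} (hQ : Pairwise fun a b => Disjoint (Q a) (Q b))
    {a b : Option ι} (hab : a ≠ b) : Disjoint (block Q a) (block Q b) := by
  have h : ∀ c, Disjoint (Q c) (⋃ c, Q c)ᶜ := fun c =>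
    Set.disjoint_compl_right_iff_subset.2 (Set.subset_iUnion Q c)
  match a, b with
  | none, none => exact absurd rfl hab
  | some c, none => exact h c
  | none, some c => exact (h c).symm
  | some a, some b => exact hQ (fun h => hab (by rw [h]))

variable [Fintype ι] [DecidableEq ι]

lemma countEvent_eq {Q : ι → Set Ω} (hQ : Pairwise fun a b => Disjoint (Q a) (Q b))
    (k : ι → ℕ) :
    countEvent n Q k = ⋃ f ∈ labelings n k, Set.univ.pi fun i => block Q (f i) := by
  have key : ∀ (X : Fin n → Ω) (f : Fin n → Option ι), (∀ i, X i ∈ block Q (f i)) → ∀ c,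
      {i | X i ∈ Q c} = ((Finset.univ.filter fun i => f i = some c : Finset (Fin n)) : Set _) := by
    intro X f hf c
    ext i
    simp only [Set.mem_ofPred_eq, Finset.coe_filter, Finset.mem_univ, true_and]
    constructor
    · intro h
      by_contra hne
      exact Set.disjoint_left.1 (block_disjoint hQ hne) (hf i) h
    · intro h
      have := hf i
      rwa [h] at this
  ext X
  simp only [countEvent, Set.mem_ofPred_eq, Set.mem_iUnion, Set.mem_univ_pi, exists_prop]
  constructor
  · intro h
    choose f hf using fun i => exists_mem_block Q (X i)
    refine ⟨f, mem_labelings.2 fun c => ?_, hf⟩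
    rw [← h c, key X f hf c, Set.ncard_coe_finset]
  · rintro ⟨f, hf, hX⟩ c
    rw [key X f hX c, Set.ncard_coe_finset]
    exact mem_labelings.1 hf c

variable [MeasurableSpace Ω] {μ : Measure Ω} [IsProbabilityMeasure μ]

lemma measurableSet_block {Q : ι → Set Ω} (hm : ∀ c, MeasurableSet (Q c)) (o : Option ι) :
    MeasurableSet (block Q o) := by
  match o with
  | none => exact (MeasurableSet.iUnion hm).compl
  | some c => exact hm c

lemma measurableSet_countEvent {Q : ι → Set Ω} (hQ : Pairwise fun a b => Disjoint (Q a) (Q b))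
    (hm : ∀ c, MeasurableSet (Q c)) (k : ι → ℕ) : MeasurableSet (countEvent n Q k) := by
  rw [countEvent_eq hQ]
  exact Finset.measurableSet_biUnion _ fun f _ =>
    MeasurableSet.univ_pi fun i => measurableSet_block hm _

lemma pi_real_pi (B : Fin n → Set Ω) :
    (Measure.pi fun _ : Fin n => μ).real (Set.univ.pi B) = ∏ i, μ.real (B i) := by
  simp [Measure.real, Measure.pi_pi, ENNReal.toReal_prod]

lemma real_countEvent {Q : ι → Set Ω} (hQ : Pairwise fun a b => Disjoint (Q a) (Q b))
    (hm : ∀ c, MeasurableSet (Q c)) (k : ι → ℕ) :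
    (Measure.pi fun _ : Fin n => μ).real (countEvent n Q k)
      = ∑ f ∈ labelings n k, ∏ i, μ.real (block Q (f i)) := by
  rw [countEvent_eq hQ, measureReal_biUnion_finset]
  · exact Finset.sum_congr rfl fun f _ => pi_real_pi _
  · intro f _ g _ hfg
    obtain ⟨i, hi⟩ := Function.ne_iff.1 hfg
    refine Set.disjoint_left.2 fun X hX hX' => ?_
    exact Set.disjoint_left.1 (block_disjoint hQ hi) (hX i trivial) (hX' i trivial)
  · exact fun f _ => MeasurableSet.univ_pi fun i => measurableSet_block hm _

lemma real_block_none {Q : ι → Set Ω} (hQ : Pairwise fun a b => Disjoint (Q a) (Q b))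
    (hm : ∀ c, MeasurableSet (Q c)) {w : ℝ} (hw : ∀ c, μ.real (Q c) = w) :
    μ.real (block Q none) = 1 - Fintype.card ι * w := by
  rw [block, measureReal_compl (MeasurableSet.iUnion hm), probReal_univ,
    ← Set.biUnion_univ, ← Finset.coe_univ]
  have := measureReal_biUnion_finset (μ := μ) (s := Finset.univ) (f := Q)
    (fun a _ b _ hab => hQ hab) (fun c _ => hm c)
  simp only [Finset.mem_coe] at this ⊢
  rw [this]
  simp [hw]

lemma prod_real_block {Q : ι → Set Ω} {w u : ℝ} (hw : ∀ c, μ.real (Q c) = w)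
    (hu : μ.real (block Q none) = u) {k : ι → ℕ} {f : Fin n → Option ι} (hf : f ∈ labelings n k) :
    ∏ i, μ.real (block Q (f i)) = w ^ (∑ c, k c) * u ^ (n - ∑ c, k c) := by
  rw [← Finset.prod_fiberwise (s := Finset.univ) (g := f), Fintype.prod_option, mul_comm]
  congr 1
  · rw [← Finset.prod_pow_eq_pow_sum]
    refine Finset.prod_congr rfl fun c _ => ?_
    rw [← mem_labelings.1 hf c]
    refine Finset.prod_eq_pow_card fun i hi => ?_
    rw [(Finset.mem_filter.1 hi).2]
    exact hw c
  · have h := sum_card_fibers hf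
    have h' : (Finset.univ.filter fun i => f i = none).card = n - ∑ c, k c := by omega
    rw [← h']
    refine Finset.prod_eq_pow_card fun i hi => ?_
    rw [(Finset.mem_filter.1 hi).2]
    exact hu

/-- Cells of equal measure give every labeling the same weight, so the probability does not depend
on the position of the window; the second moment argument relies on this. -/
lemma real_countEvent_eq {Q : ι → Set Ω} (hQ : Pairwise fun a b => Disjoint (Q a) (Q b))
    (hm : ∀ c, MeasurableSet (Q c)) {w : ℝ} (hw : ∀ c, μ.real (Q c) = w) (k : ι → ℕ) :
    (Measure.pi fun _ : Fin n => μ).real (countEvent n Q k) = (labelings n k).card *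
      (w ^ (∑ c, k c) * (1 - Fintype.card ι * w) ^ (n - ∑ c, k c)) := by
  rw [real_countEvent hQ hm, Finset.sum_congr rfl fun f hf =>
    prod_real_block hw (real_block_none hQ hm hw) hf]
  simp

/-- The numbers of points in the cells of two disjoint windows are almost negatively
correlated. -/
lemma real_countEvent_inter_le {Q Q' : ι → Set Ω}
    (hQ : Pairwise fun a b => Disjoint (Q a) (Q b))
    (hQ' : Pairwise fun a b => Disjoint (Q' a) (Q' b))
    (hQQ' : ∀ a b, Disjoint (Q a) (Q' b))
    (hm : ∀ c, MeasurableSet (Q c)) (hm' : ∀ c, MeasurableSet (Q' c))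
    {w : ℝ} (hw : ∀ c, μ.real (Q c) = w) (hw' : ∀ c, μ.real (Q' c) = w)
    (hw1 : Fintype.card ι * w < 1) (k : ι → ℕ) :
    (Measure.pi fun _ : Fin n => μ).real (countEvent n Q k ∩ countEvent n Q' k) ≤
      (Measure.pi fun _ : Fin n => μ).real (countEvent n Q k) *
      (Measure.pi fun _ : Fin n => μ).real (countEvent n Q' k) *
        ((1 - Fintype.card ι * w)⁻¹ ^ (∑ c, k c)) ^ 2 := by
  set u : ℝ := 1 - Fintype.card ι * w with hu
  have hu0 : 0 < u := by linarith
  have hn := real_block_none hQ hm hw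
  have hn' := real_block_none hQ' hm' hw'
  -- A point in a cell of one window is automatically outside the other, so the product of the two
  -- weights misses a factor `u⁻¹`, which is charged to the cell. For points outside both windows no
  -- charge is needed, since `1 - 2x ≤ (1 - x)^2` with `x = 1 - u`.
  let t : Option ι → ℝ := fun o => o.elim 1 fun _ => u⁻¹
  have ht : ∀ f ∈ labelings n k, ∏ i, t (f i) = u⁻¹ ^ (∑ c, k c) := by
    intro f hf
    rw [← Finset.prod_fiberwise (s := Finset.univ) (g := f), Fintype.prod_option,
      ← Finset.prod_pow_eq_pow_sum]
    have h1 : ∏ i ∈ Finset.univ.filter (fun i => f i = none), t (f i) = 1 :=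
      Finset.prod_eq_one fun i hi => by rw [(Finset.mem_filter.1 hi).2]; rfl
    rw [h1, one_mul]
    refine Finset.prod_congr rfl fun c _ => ?_
    rw [← mem_labelings.1 hf c]
    refine Finset.prod_eq_pow_card fun i hi => ?_
    rw [(Finset.mem_filter.1 hi).2]
    rfl
  have hdiff : ∀ a b : Option ι, μ.real (block Q a ∩ block Q' b)
      ≤ (μ.real (block Q a) * t a) * (μ.real (block Q' b) * t b) := by
    intro a b
    match a, b with
    | some a, some b =>
      have : block Q (some a) ∩ block Q' (some b) = ∅ := (hQQ' a b).inter_eq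
      rw [this, measureReal_empty]
      have : 0 ≤ u⁻¹ := inv_nonneg.2 hu0.le
      exact mul_nonneg (mul_nonneg measureReal_nonneg this) (mul_nonneg measureReal_nonneg this)
    | some a, none =>
      rw [hn', ← hu]
      simp only [t, Option.elim]
      rw [mul_one, mul_assoc, inv_mul_cancel₀ hu0.ne', mul_one]
      exact measureReal_mono Set.inter_subset_left
    | none, some b =>
      rw [hn, ← hu]
      simp only [t, Option.elim]
      rw [mul_one, mul_comm u, mul_assoc, inv_mul_cancel₀ hu0.ne', mul_one]
      exact measureReal_mono Set.inter_subset_right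
    | none, none =>
      have hD : Disjoint (⋃ c, Q c) (⋃ c, Q' c) := by
        simp only [Set.disjoint_iUnion_left, Set.disjoint_iUnion_right]
        exact fun b a => hQQ' a b
      have e : block Q none ∩ block Q' none = block Q none \ (⋃ c, Q' c) := rfl
      have e' : μ.real (⋃ c, Q' c) = Fintype.card ι * w := by
        have := measureReal_compl (μ := μ) (MeasurableSet.iUnion hm')
        rw [probReal_univ] at this
        change μ.real (block Q' none) = _ at this
        linarith
      have hsub : (⋃ c, Q' c) ⊆ block Q none := Set.subset_compl_iff_disjoint_left.2 hD
      rw [e, measureReal_sdiff hsub (MeasurableSet.iUnion hm'), e', hn, hn', ← hu]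
      simp only [t, Option.elim, mul_one]
      nlinarith [sq_nonneg (Fintype.card ι * w)]
  have hsub : countEvent n Q k ∩ countEvent n Q' k ⊆
      ⋃ p ∈ labelings n k ×ˢ labelings n k,
        Set.univ.pi fun i => block Q (p.1 i) ∩ block Q' (p.2 i) := by
    rw [countEvent_eq hQ, countEvent_eq hQ']
    rintro X ⟨h1, h2⟩
    simp only [Set.mem_iUnion, exists_prop] at h1 h2 ⊢
    obtain ⟨f, hf, hX⟩ := h1
    obtain ⟨g, hg, hX'⟩ := h2
    exact ⟨(f, g), Finset.mk_mem_product hf hg, fun i _ => ⟨hX i trivial, hX' i trivial⟩⟩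
  refine (measureReal_mono hsub (measure_ne_top _ _)).trans ((measureReal_biUnion_finset_le _ _).trans ?_)
  rw [real_countEvent hQ hm, real_countEvent hQ' hm', Finset.sum_mul_sum, ← Finset.sum_product',
    Finset.sum_mul]
  refine Finset.sum_le_sum fun p hp => ?_
  obtain ⟨h1, h2⟩ := Finset.mem_product.1 hp
  rw [pi_real_pi]
  refine (Finset.prod_le_prod (fun _ _ => measureReal_nonneg) fun i _ => hdiff _ _).trans ?_
  rw [Finset.prod_mul_distrib, Finset.prod_mul_distrib, Finset.prod_mul_distrib, ht _ h1, ht _ h2]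
  exact le_of_eq (by ring)

end Counts

/-! ### Second moment bound and Poisson weights. -/

/-- Chebyshev's inequality for a finite family of equally likely, almost uncorrelated events. -/
lemma real_iInter_compl_le {Ω J : Type*} [Fintype J] [DecidableEq J] [MeasurableSpace Ω]
    (P : Measure Ω) [IsProbabilityMeasure P] (E : J → Set Ω) (hE : ∀ j, MeasurableSet (E j))
    {p t : ℝ} (hp : ∀ j, P.real (E j) = p) (ht : 0 ≤ t)
    (hpair : ∀ i j, i ≠ j → P.real (E i ∩ E j) ≤ p * p * t) :
    P.real (⋂ j, (E j)ᶜ) * (Fintype.card J * p) ^ 2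
      ≤ Fintype.card J * p + (Fintype.card J * p) ^ 2 * (t - 1) := by
  set m : ℝ := (Fintype.card J : ℝ) with hm
  let Z : Ω → ℝ := fun x => ∑ j, (E j).indicator 1 x
  have hint : ∀ s : Set Ω, MeasurableSet s → Integrable (s.indicator (1 : Ω → ℝ)) P :=
    fun s hs => (integrable_const (1 : ℝ)).indicator hs
  have hZ : Integrable Z P := integrable_finsetSum _ fun j _ => hint _ (hE j)
  have hZ1 : ∫ x, Z x ∂P = m * p := by
    simp only [Z]
    rw [integral_finsetSum _ fun j _ => hint _ (hE j)]
    simp [integral_indicator_one (hE _), hp, hm]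
  have hZsq : ∀ x, Z x ^ 2 = ∑ i, ∑ j, (E i ∩ E j).indicator (1 : Ω → ℝ) x := by
    intro x
    simp only [Z]
    rw [sq, Finset.sum_mul_sum]
    refine Finset.sum_congr rfl fun i _ => Finset.sum_congr rfl fun j _ => ?_
    rw [Set.inter_indicator_one]
    rfl
  have hZ2i : Integrable (fun x => Z x ^ 2) P := by
    simp only [hZsq]
    exact integrable_finsetSum _ fun i _ => integrable_finsetSum _ fun j _ =>
      hint _ ((hE i).inter (hE j))
  have hZ2 : ∫ x, Z x ^ 2 ∂P ≤ m * p + m ^ 2 * (p * p * t) := by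
    simp only [hZsq]
    rw [integral_finsetSum _ fun i _ => integrable_finsetSum _ fun j _ =>
      hint _ ((hE i).inter (hE j))]
    have hp0 : 0 ≤ p * p * t := mul_nonneg (mul_self_nonneg p) ht
    have : ∀ i : J, ∫ x, ∑ j, (E i ∩ E j).indicator (1 : Ω → ℝ) x ∂P ≤ p + m * (p * p * t) := by
      intro i
      rw [integral_finsetSum _ fun j _ => hint _ ((hE i).inter (hE j))]
      simp only [integral_indicator_one ((hE i).inter (hE _))]
      have : ∀ j ∈ Finset.univ, P.real (E i ∩ E j) ≤ (if i = j then p else 0) + p * p * t := by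
        intro j _
        split_ifs with h
        · subst h
          rw [Set.inter_self, hp]
          linarith
        · rw [zero_add]
          exact hpair i j h
      refine (Finset.sum_le_sum this).trans (le_of_eq ?_)
      rw [Finset.sum_add_distrib]
      simp [hm]
    refine (Finset.sum_le_sum fun i _ => this i).trans (le_of_eq ?_)
    simp only [Finset.sum_const, Finset.card_univ, nsmul_eq_mul, ← hm]
    ring
  have hmeas : MeasurableSet (⋂ j, (E j)ᶜ) := MeasurableSet.iInter fun j => (hE j).compl
  -- Where no event occurs the count `Z` vanishes and so deviates from its mean by all of `m * p`.
  have hle : ∀ x, (⋂ j, (E j)ᶜ).indicator (fun _ => (m * p) ^ 2) x ≤ (Z x - m * p) ^ 2 := by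
    intro x
    by_cases hx : x ∈ ⋂ j, (E j)ᶜ
    · rw [Set.indicator_of_mem hx]
      have : Z x = 0 := Finset.sum_eq_zero fun j _ =>
        Set.indicator_of_notMem (Set.mem_iInter.1 hx j) _
      rw [this]
      simp
    · rw [Set.indicator_of_notMem hx]
      positivity
  have hexp : ∀ x, (Z x - m * p) ^ 2 = Z x ^ 2 - 2 * (m * p) * Z x + (m * p) ^ 2 := fun x => by ring
  have hI1 : Integrable (fun x => Z x ^ 2 - 2 * (m * p) * Z x) P := hZ2i.sub (hZ.const_mul _)
  have hI : Integrable (fun x => (Z x - m * p) ^ 2) P := by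
    simp only [hexp]
    exact hI1.add (integrable_const _)
  have := integral_mono ((integrable_const _).indicator hmeas) hI hle
  rw [integral_indicator hmeas, setIntegral_const, smul_eq_mul] at this
  simp only [hexp] at this
  rw [integral_add hI1 (integrable_const _), integral_sub hZ2i (hZ.const_mul _),
    integral_const_mul, hZ1] at this
  simp only [integral_const, probReal_univ, smul_eq_mul, one_mul] at this
  linarith

/-- A crude form of Stirling's bound; the induction step is `e ≤ (1 + 1/k)^(k+1)`. -/
lemma factorial_mul_exp_le {k : ℕ} (hk : 1 ≤ k) :
    (k.factorial : ℝ) * Real.exp k ≤ Real.exp 1 * k * (k : ℝ) ^ k := by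
  induction k, hk using Nat.le_induction with
  | base => simp
  | succ k hk ih =>
    have hk0 : (0 : ℝ) < k := by exact_mod_cast hk
    have hstep : Real.exp 1 * (k : ℝ) ^ (k + 1) ≤ ((k : ℝ) + 1) ^ (k + 1) := by
      have h1 : Real.exp (1 / (k + 1)) ≤ ((k : ℝ) + 1) / k := by
        rw [← Real.le_log_iff_exp_le (by positivity)]
        refine le_trans (le_of_eq ?_) (Real.one_sub_inv_le_log_of_pos (by positivity))
        field_simp
        ring
      have h2 := pow_le_pow_left₀ (Real.exp_pos _).le h1 (k + 1)
      rw [← Real.exp_nat_mul, div_pow, le_div_iff₀ (by positivity)] at h2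
      have h3 : ((k + 1 : ℕ) : ℝ) * (1 / (k + 1)) = 1 := by
        push_cast
        field_simp
      rwa [h3] at h2
    rw [Nat.factorial_succ]
    push_cast
    rw [Real.exp_add]
    calc ((k : ℝ) + 1) * k.factorial * (Real.exp k * Real.exp 1)
        = (k + 1) * Real.exp 1 * (k.factorial * Real.exp k) := by ring
      _ ≤ (k + 1) * Real.exp 1 * (Real.exp 1 * k * (k : ℝ) ^ k) := by gcongr
      _ = (k + 1) * Real.exp 1 * (Real.exp 1 * (k : ℝ) ^ (k + 1)) := by ring
      _ ≤ (k + 1) * Real.exp 1 * ((k : ℝ) + 1) ^ (k + 1) := by gcongr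
      _ = _ := by ring

/-- A lower bound for the Poisson weights of mean `a` at `⌊l * a⌋`. -/
lemma exp_le_pow_div_factorial {a l : ℝ} (ha : 0 < a) (hl : 0 ≤ l) (hl2 : l ≤ 2) :
    Real.exp (a * (1 - (l - 1) ^ 2) - 2) / (Real.exp 1 * (2 * a + 1)) ≤
      a ^ ⌊l * a⌋₊ / (⌊l * a⌋₊.factorial : ℝ) := by
  set k := ⌊l * a⌋₊ with hk
  have hk1 : (k : ℝ) ≤ l * a := Nat.floor_le (by positivity)
  have hk2 : l * a < k + 1 := Nat.lt_floor_add_one _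
  have hk3 : (k : ℝ) ≤ 2 * a := hk1.trans (by gcongr)
  have he : (1 : ℝ) ≤ Real.exp 1 := Real.one_le_exp (by norm_num)
  rcases Nat.eq_zero_or_pos k with h0 | hpos
  · rw [h0] at hk2 ⊢
    simp only [Nat.cast_zero, zero_add] at hk2
    rw [pow_zero, Nat.factorial_zero, Nat.cast_one, div_one, div_le_one (by positivity)]
    have : a * (1 - (l - 1) ^ 2) - 2 ≤ 0 := by nlinarith
    calc Real.exp (a * (1 - (l - 1) ^ 2) - 2) ≤ 1 := Real.exp_le_one_iff.2 this
      _ ≤ Real.exp 1 * (2 * a + 1) := by nlinarith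
  · have hk0 : (0 : ℝ) < k := by exact_mod_cast hpos
    have hk1' : (1 : ℝ) ≤ k := by exact_mod_cast hpos
    have hst := factorial_mul_exp_le hpos
    -- This replaces the Poisson rate by a quadratic: `log x ≥ 1 - x⁻¹` bounds the right side below
    -- by `k * (2 - k/a) = a * (1 - (k/a - 1)^2)`. Passing from `k / a` to `l` moves this by at most
    -- `2`, because `k` is within `1` of `l * a` and both ratios lie in `[0, 2]`.
    have hexp : a * (1 - (l - 1) ^ 2) - 2 ≤ k * Real.log (a / k) + k := by
      have hlog := Real.one_sub_inv_le_log_of_pos (x := a / k) (by positivity)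
      have h1 : a * (1 - (l - 1) ^ 2) - 2 ≤ k * (2 - k / a) := by
        rw [← sub_nonneg]
        have : k * (2 - k / a) - (a * (1 - (l - 1) ^ 2) - 2)
          = ((l * a - k) * (2 * (l * a) - 2 * a - (l * a - k)) + 2 * a) / a := by
          field_simp
          ring
        rw [this]
        refine div_nonneg ?_ ha.le
        nlinarith [mul_nonneg (sub_nonneg.2 hk1) (sub_nonneg.2 hk3), mul_nonneg (sub_nonneg.2 hk1) ha.le,
          mul_nonneg (sub_nonneg.2 hk1) hk0.le]
      have h2 : (k : ℝ) * (2 - k / a) ≤ k * Real.log (a / k) + k := by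
        rw [inv_div] at hlog
        nlinarith
      exact h1.trans h2
    have hpow : Real.exp (k * Real.log (a / k) + k) = (a / k) ^ k * Real.exp k := by
      rw [Real.exp_add, Real.exp_nat_mul, Real.exp_log (by positivity)]
    calc Real.exp (a * (1 - (l - 1) ^ 2) - 2) / (Real.exp 1 * (2 * a + 1))
        ≤ ((a / k) ^ k * Real.exp k) / (Real.exp 1 * k) := by
          rw [← hpow]
          gcongr
          linarith
      _ ≤ a ^ k / k.factorial := by
          rw [div_pow, div_le_div_iff₀ (by positivity) (by positivity)]
          calc a ^ k / (k : ℝ) ^ k * Real.exp k * k.factorial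
              = a ^ k / (k : ℝ) ^ k * (k.factorial * Real.exp k) := by ring
            _ ≤ a ^ k / (k : ℝ) ^ k * (Real.exp 1 * k * (k : ℝ) ^ k) := by gcongr
            _ = _ := by field_simp

/-! ### The probability that a window shows a prescribed profile. -/

section Window

variable {ι : Type*} [Fintype ι] [DecidableEq ι]

lemma sum_floor_le {a : ℝ} (ha : 0 ≤ a) {l : ι → ℝ} (hl : ∀ c, 0 ≤ l c)
    (hl2 : ∀ c, l c ≤ 2) :
    ((∑ c, ⌊l c * a⌋₊ : ℕ) : ℝ) ≤ 2 * Fintype.card ι * a := by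
  push_cast
  calc ∑ c, (⌊l c * a⌋₊ : ℝ) ≤ ∑ _c : ι, 2 * a := Finset.sum_le_sum fun c _ =>
        (Nat.floor_le (mul_nonneg (hl c) ha)).trans (mul_le_mul_of_nonneg_right (hl2 c) ha)
    _ = _ := by simp; ring

/-- A lower bound for the probability of seeing the densities `l` in a given window. -/
lemma le_card_labelings_mul [Nonempty ι] {n : ℕ} {a : ℝ} (ha : 1 ≤ a) {l : ι → ℝ}
    (hl : ∀ c, 0 ≤ l c) (hl2 : ∀ c, l c ≤ 2) (hn : 8 * (Fintype.card ι * a) ^ 2 ≤ n) :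
    Real.exp (-(a * ∑ c, (l c - 1) ^ 2)) *
      (Real.exp (-(1 + 2 * Fintype.card ι)) / (2 * (Real.exp 1 * (2 * a + 1)) ^ Fintype.card ι)) ≤
    (labelings n fun c => ⌊l c * a⌋₊).card *
      ((a / n) ^ (∑ c, ⌊l c * a⌋₊) *
        (1 - Fintype.card ι * (a / n)) ^ (n - ∑ c, ⌊l c * a⌋₊)) := by
  set k : ι → ℕ := fun c => ⌊l c * a⌋₊ with hk
  set K := ∑ c, k c with hK
  set M := Fintype.card ι with hM
  have hM1 : (1 : ℝ) ≤ M := by exact_mod_cast Fintype.card_pos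
  have hKle : (K : ℝ) ≤ 2 * M * a := sum_floor_le (by linarith) hl hl2
  have hMa : 1 ≤ M * a := one_le_mul_of_one_le_of_one_le hM1 ha
  have hn0 : (0 : ℝ) < n := by nlinarith
  have hKn : K ≤ n := by
    have : (K : ℝ) ≤ n := by nlinarith
    exact_mod_cast this
  have hK2 : 2 * (K : ℝ) ^ 2 ≤ n := by
    have : (K : ℝ) ^ 2 ≤ (2 * M * a) ^ 2 := by gcongr
    nlinarith
  set x : ℝ := M * (a / n) with hx
  have hx0 : 0 ≤ x := by positivity
  have hxn : x * n = M * a := by rw [hx]; field_simp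
  have hx8 : x ≤ 1 / 2 := by
    have : x = M * a / n := by rw [hx]; ring
    rw [this, div_le_iff₀ hn0]
    nlinarith
  -- The window is left empty by the other points with the Poisson probability `exp (-M a)` up to
  -- the factor `e⁻¹`: the second-order error `n * (2 * x^2)` is at most `1` because `n ≥ 8 (M
  -- a)^2`.
  have hx1 : Real.exp (-(M * a) - 1) ≤ (1 - x) ^ (n - K) := by
    have h1 : Real.exp (-(x / (1 - x))) ≤ 1 - x := by
      rw [← Real.le_log_iff_exp_le (by linarith)]
      refine le_trans (le_of_eq ?_) (Real.one_sub_inv_le_log_of_pos (by linarith))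
      have : 1 - x ≠ 0 := by linarith
      field_simp
      ring
    calc Real.exp (-(M * a) - 1) ≤ Real.exp (n * (-(x / (1 - x)))) := by
          apply Real.exp_le_exp.2
          have h2 : x / (1 - x) ≤ x + 2 * x ^ 2 := by
            rw [div_le_iff₀ (by linarith)]
            nlinarith [mul_nonneg hx0 hx0]
          have h3 : n * (2 * x ^ 2) ≤ 1 := by
            have : n * (2 * x ^ 2) * n = 2 * (M * a) ^ 2 := by rw [← hxn]; ring
            have h4 : n * (2 * x ^ 2) * n ≤ 1 * n := by rw [this]; nlinarith
            exact le_of_mul_le_mul_right h4 hn0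
          nlinarith
      _ = (Real.exp (-(x / (1 - x)))) ^ n := by rw [Real.exp_nat_mul]
      _ ≤ (1 - x) ^ n := pow_le_pow_left₀ (Real.exp_pos _).le h1 n
      _ ≤ (1 - x) ^ (n - K) := pow_le_pow_of_le_one (by linarith) (by linarith) (Nat.sub_le _ _)
  -- The multinomial coefficient is at least `(n - K)^K / ∏ k c !`. Bernoulli's inequality then
  -- gives `(n - K)^K ≥ n^K / 2`, so that only Poisson weights remain.
  have hcard : ((n : ℝ) - K) ^ K ≤ (labelings n k).card * ∏ c, ((k c).factorial : ℝ) := by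
    have h1 := factorial_le_card_labelings (k := k) hKn
    rw [← Nat.factorial_mul_descFactorial hKn, mul_assoc] at h1
    have h2 := Nat.le_of_mul_le_mul_left h1 (Nat.factorial_pos _)
    have h3 : (n - K) ^ K ≤ (∏ c, (k c).factorial) * (labelings n k).card :=
      (Nat.pow_le_pow_left (by omega) K).trans ((Nat.pow_sub_le_descFactorial n K).trans h2)
    rw [mul_comm]
    have h4 : (((n - K) ^ K : ℕ) : ℝ) ≤ ((∏ c, (k c).factorial) * (labelings n k).card : ℕ) := by
      exact_mod_cast h3
    push_cast [Nat.cast_sub hKn] at h4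
    exact h4
  have hbern : 1 / 2 ≤ (1 - K / n : ℝ) ^ K := by
    have h := one_add_mul_le_pow (a := -(K / n : ℝ)) (by
      rw [neg_le_neg_iff, div_le_iff₀ hn0]
      have : (K : ℝ) ≤ n := by exact_mod_cast hKn
      linarith) K
    refine le_trans ?_ (h.trans (le_of_eq (by ring)))
    have : (K : ℝ) * (K / n) ≤ 1 / 2 := by
      rw [mul_div_assoc', div_le_iff₀ hn0]
      nlinarith
    linarith
  have hprod : ∏ c, Real.exp (a * (1 - (l c - 1) ^ 2) - 2) / (Real.exp 1 * (2 * a + 1)) ≤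
      ∏ c, a ^ k c / ((k c).factorial : ℝ) :=
    Finset.prod_le_prod (fun c _ => by positivity) fun c _ =>
      exp_le_pow_div_factorial (by linarith) (hl c) (hl2 c)
  rw [Finset.prod_div_distrib, Finset.prod_div_distrib, ← Real.exp_sum, Finset.sum_sub_distrib,
    ← Finset.mul_sum, Finset.sum_sub_distrib] at hprod
  simp only [Finset.sum_const, Finset.prod_const, Finset.card_univ, nsmul_eq_mul, ← hM, mul_one]
    at hprod
  rw [Finset.prod_pow_eq_pow_sum, ← hK] at hprod
  have hF : (0 : ℝ) < ∏ c, ((k c).factorial : ℝ) :=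
    Finset.prod_pos fun c _ => by exact_mod_cast Nat.factorial_pos _
  calc _ = Real.exp (a * (M - ∑ c, (l c - 1) ^ 2) - M * 2) / (Real.exp 1 * (2 * a + 1)) ^ M *
        (1 / 2) * Real.exp (-(M * a) - 1) := by
        have : Real.exp (-(a * ∑ c, (l c - 1) ^ 2)) * Real.exp (-(1 + 2 * (M : ℝ))) =
            Real.exp (a * (M - ∑ c, (l c - 1) ^ 2) - M * 2) * Real.exp (-(M * a) - 1) := by
          rw [← Real.exp_add, ← Real.exp_add]
          congr 1
          ring
        rw [mul_div_assoc', this]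
        field_simp
    _ ≤ (a ^ K / ∏ c, ((k c).factorial : ℝ)) * (1 - K / n : ℝ) ^ K * (1 - x) ^ (n - K) := by
        gcongr
    _ = ((n : ℝ) - K) ^ K / (∏ c, ((k c).factorial : ℝ)) * (a / n) ^ K * (1 - x) ^ (n - K) := by
        have : (n : ℝ) - K = n * (1 - K / n) := by field_simp
        rw [this, mul_pow, div_pow]
        field_simp
    _ ≤ (labelings n k).card * (a / n) ^ K * (1 - x) ^ (n - K) := by
        have : 0 ≤ (1 - x) ^ (n - K) := pow_nonneg (by linarith) _
        gcongr
        rwa [div_le_iff₀ hF]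
    _ = _ := by ring

/-- Among many disjoint windows, one of them shows the densities `l`, with high probability. -/
lemma real_no_window_le [Nonempty ι] {Ω J : Type*} [MeasurableSpace Ω] {μ : Measure Ω}
    [IsProbabilityMeasure μ] [Fintype J] [DecidableEq J] [Nonempty J] {n : ℕ} {a : ℝ}
    (ha : 1 ≤ a) {l : ι → ℝ} (hl : ∀ c, 0 ≤ l c) (hl2 : ∀ c, l c ≤ 2)
    (hn : 8 * (Fintype.card ι * a) ^ 2 ≤ n) (Q : J → ι → Set Ω)
    (hQ : ∀ i j a b, (i, a) ≠ (j, b) → Disjoint (Q i a) (Q j b))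
    (hm : ∀ j c, MeasurableSet (Q j c)) (hw : ∀ j c, μ.real (Q j c) = a / n) :
    (Measure.pi fun _ : Fin n => μ).real
        (⋂ j, (countEvent n (Q j) fun c => ⌊l c * a⌋₊)ᶜ) ≤
      (Fintype.card J * (Real.exp (-(a * ∑ c, (l c - 1) ^ 2)) *
        (Real.exp (-(1 + 2 * Fintype.card ι)) /
          (2 * (Real.exp 1 * (2 * a + 1)) ^ Fintype.card ι))))⁻¹ +
      8 * (Fintype.card ι * a) ^ 2 / n := by
  set k : ι → ℕ := fun c => ⌊l c * a⌋₊ with hk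
  set P := Measure.pi fun _ : Fin n => μ
  have hQj : ∀ j, Pairwise fun a b => Disjoint (Q j a) (Q j b) := fun j a b hab =>
    hQ j j a b (by simpa using hab)
  have hp := fun j => real_countEvent_eq (n := n) (hQj j) (hm j) (hw j) k
  have hlow := le_card_labelings_mul (ι := ι) ha hl hl2 hn
  set p0 := Real.exp (-(a * ∑ c, (l c - 1) ^ 2)) * (Real.exp (-(1 + 2 * (Fintype.card ι : ℝ))) /
          (2 * (Real.exp 1 * (2 * a + 1)) ^ Fintype.card ι)) with hp0
  set p : ℝ := (labelings n fun c => ⌊l c * a⌋₊).card *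
      ((a / n) ^ (∑ c, ⌊l c * a⌋₊) *
        (1 - Fintype.card ι * (a / n)) ^ (n - ∑ c, ⌊l c * a⌋₊)) with hpdef
  have hp0pos : 0 < p0 := by positivity
  have hppos : 0 < p := hp0pos.trans_le hlow
  set M := Fintype.card ι with hM
  have hM1 : (1 : ℝ) ≤ M := by exact_mod_cast Fintype.card_pos
  have hMa : 1 ≤ M * a := one_le_mul_of_one_le_of_one_le hM1 ha
  have hn0 : (0 : ℝ) < n := by nlinarith
  set K := ∑ c, k c with hK
  have hKle : (K : ℝ) ≤ 2 * M * a := sum_floor_le (by linarith) hl hl2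
  set x : ℝ := M * (a / n) with hx
  have hx0 : 0 ≤ x := by positivity
  have hxn : x * n = M * a := by rw [hx]; field_simp
  have hx8 : x ≤ 1 / 2 := by
    have : x = M * a / n := by rw [hx]; ring
    rw [this, div_le_iff₀ hn0]
    nlinarith
  have hm0 : (0 : ℝ) < Fintype.card J := by exact_mod_cast Fintype.card_pos
  set t := ((1 - x)⁻¹ ^ K) ^ 2 with ht
  set τ : ℝ := 4 * (M * a) ^ 2 / n with hτ
  have hτ0 : 0 ≤ τ := by positivity
  have hτ2 : τ ≤ 1 / 2 := by
    rw [hτ, div_le_iff₀ hn0]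
    linarith
  -- Here `t = (1 - x)^(-2K)` with `K ≤ 2 M a` and `x = M a / n`, so `2 K x ≤ τ`. Bernoulli gives
  -- `t⁻¹ ≥ 1 - τ`, and `τ ≤ 1/2` turns this into the bound on `t - 1`.
  have htle : t - 1 ≤ 2 * τ := by
    have h1 : 1 - τ ≤ (1 - x) ^ (K * 2) := by
      have h := one_add_mul_le_pow (a := -x) (by linarith) (K * 2)
      rw [← sub_eq_add_neg] at h
      refine le_trans ?_ h
      have h2 : (K : ℝ) * 2 * x ≤ τ := by
        rw [hτ, le_div_iff₀ hn0, mul_assoc, hxn]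
        nlinarith
      push_cast
      linarith
    have h2 : t = ((1 - x) ^ (K * 2))⁻¹ := by rw [ht, ← pow_mul, inv_pow]
    rw [h2, sub_le_iff_le_add, inv_le_comm₀ (by linarith) (by linarith)]
    refine le_trans ?_ h1
    rw [inv_eq_one_div, div_le_iff₀ (by linarith)]
    nlinarith
  have hcheb := real_iInter_compl_le P (fun j => countEvent n (Q j) k)
    (fun j => measurableSet_countEvent (hQj j) (hm j) k) (p := p) (t := t) (fun j => hp j)
    (by positivity) (by
      intro i j hij
      have := real_countEvent_inter_le (n := n) (hQj i) (hQj j)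
        (fun a b => hQ i j a b (by simp [hij])) (hm i) (hm j) (hw i) (hw j) (by linarith) k
      rwa [hp i, hp j] at this)
  set S := (Fintype.card J : ℝ) * p with hS
  have hSpos : 0 < S := by positivity
  have hS0 : S⁻¹ ≤ (Fintype.card J * p0)⁻¹ := by
    exact inv_anti₀ (mul_pos hm0 hp0pos) (mul_le_mul_of_nonneg_left hlow hm0.le)
  have h1 : P.real (⋂ j, (countEvent n (Q j) k)ᶜ) ≤ S⁻¹ + (t - 1) := by
    have h2 : P.real (⋂ j, (countEvent n (Q j) k)ᶜ) * S ^ 2 ≤ (S⁻¹ + (t - 1)) * S ^ 2 := by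
      refine hcheb.trans (le_of_eq ?_)
      field_simp
    exact le_of_mul_le_mul_right h2 (by positivity)
  have h3 : 2 * τ = 8 * (M * a) ^ 2 / n := by rw [hτ]; ring
  linarith

end Window

/-! ### Grid cells, and patterns that appear a.a.s. -/

/-- The index of the half-open cube of side `η` of the standard grid that contains `y`. -/
noncomputable def cell {d : ℕ} (η : ℝ) (y : EuclideanSpace ℝ (Fin d)) : Fin d → ℤ :=
  fun i => ⌊y i / η⌋

/-- The indices of the grid cubes that make up the cube `[-Nη, Nη)^d`. -/
noncomputable def window (d N : ℕ) : Finset (Fin d → ℤ) :=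
  Fintype.piFinset fun _ => Finset.Ico (-(N : ℤ)) N

lemma mem_window {d N : ℕ} {c : Fin d → ℤ} : c ∈ window d N ↔ ∀ i, -(N : ℤ) ≤ c i ∧ c i < N := by
  simp [window]

lemma card_window (d N : ℕ) : (window d N).card = (2 * N) ^ d := by
  simp only [window, Fintype.card_piFinset, Int.card_Ico, Finset.prod_const, Finset.card_univ,
    Fintype.card_fin]
  congr 1
  omega

lemma cell_eq_iff {d : ℕ} {s : ℝ} (hs : 0 < s) {x : EuclideanSpace ℝ (Fin d)} {k : Fin d → ℤ} :
    cell s x = k ↔ ∀ i, k i * s ≤ x i ∧ x i < (k i + 1) * s := by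
  simp only [funext_iff, cell, Int.floor_eq_iff, le_div_iff₀ hs, div_lt_iff₀ hs]

lemma setOf_cell_eq {d : ℕ} {s : ℝ} (hs : 0 < s) (k : Fin d → ℤ) :
    {x : EuclideanSpace ℝ (Fin d) | cell s x = k} =
      (MeasurableEquiv.toLp 2 (Fin d → ℝ)).symm ⁻¹'
        (Set.univ.pi fun i => Set.Ico (k i * s) ((k i + 1) * s)) := by
  ext x
  simp only [Set.mem_ofPred_eq, cell_eq_iff hs, Set.mem_preimage, Set.mem_univ_pi, Set.mem_Ico]
  rfl

lemma measurableSet_cell {d : ℕ} {s : ℝ} (hs : 0 < s) (k : Fin d → ℤ) :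
    MeasurableSet {x : EuclideanSpace ℝ (Fin d) | cell s x = k} := by
  rw [setOf_cell_eq hs]
  exact (MeasurableEquiv.measurable _) (MeasurableSet.univ_pi fun i => measurableSet_Ico)

lemma volume_cell {d : ℕ} {s : ℝ} (hs : 0 < s) (k : Fin d → ℤ) :
    volume {x : EuclideanSpace ℝ (Fin d) | cell s x = k} = ENNReal.ofReal (s ^ d) := by
  rw [setOf_cell_eq hs, (EuclideanSpace.volume_preserving_symm_measurableEquiv_toLp
    (Fin d)).measure_preimage_equiv, volume_pi_pi]
  have : ∀ i, volume (Set.Ico (k i * s) ((k i + 1) * s)) = ENNReal.ofReal s := by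
    intro i
    rw [Real.volume_Ico]
    congr 1
    ring
  simp [this, ENNReal.ofReal_pow hs.le]

/-- The event that some translate of the window, in units of `r`, contains exactly
`⌊l c * a⌋` points in the cell of index `c`, for each `c`. -/
def HasPattern {d n : ℕ} (N : ℕ) (η : ℝ) (l : (Fin d → ℤ) → ℝ) (a r : ℝ)
    (X : Fin n → EuclideanSpace ℝ (Fin d)) : Prop :=
  ∃ z, ∀ c ∈ window d N, {i | cell η (r⁻¹ • (X i - z)) = c}.ncard = ⌊l c * a⌋₊

/-- Windows of side `2 N η r` are placed side by side in the cube, `⌊1 / (2 N η r)⌋` along each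
axis. Rounding down costs at most a factor `2` per axis, whence `4 N` instead of `2 N` in the number
of windows. -/
lemma ofReal_le_pointsLaw_hasPattern {d n N : ℕ} (hd : d ≠ 0) (hN : N ≠ 0) {η r : ℝ} (hη : 0 < η)
    (hr : 0 < r) {l : (Fin d → ℤ) → ℝ} (hl : ∀ c, 0 ≤ l c) (hl2 : ∀ c, l c ≤ 2) {a : ℝ}
    (ha : a = η ^ d * (n * r ^ d)) (ha1 : 1 ≤ a) (hn : 8 * ((2 * N : ℝ) ^ d * a) ^ 2 ≤ n) :
    ENNReal.ofReal (1 - ((n / ((4 * N : ℝ) ^ d * a) *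
      (Real.exp (-(a * ∑ c ∈ window d N, (l c - 1) ^ 2)) *
        (Real.exp (-(1 + 2 * (2 * N : ℝ) ^ d)) /
          (2 * (Real.exp 1 * (2 * a + 1)) ^ (2 * N) ^ d))))⁻¹ +
      8 * ((2 * N : ℝ) ^ d * a) ^ 2 / n)) ≤ pointsLaw d n {X | HasPattern N η l a r X} := by
  have hN0 : (0 : ℝ) < N := by exact_mod_cast Nat.pos_of_ne_zero hN
  have hN1 : (1 : ℝ) ≤ N := by exact_mod_cast Nat.one_le_iff_ne_zero.2 hN
  have hM1 : (1 : ℝ) ≤ (2 * N : ℝ) ^ d := one_le_pow₀ (by linarith)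
  have hMa : 1 ≤ (2 * N : ℝ) ^ d * a := one_le_mul_of_one_le_of_one_le hM1 ha1
  have hn0 : (0 : ℝ) < n := by nlinarith
  set s := η * r with hs
  have hs0 : 0 < s := mul_pos hη hr
  have hsd : s ^ d = a / n := by
    rw [ha, hs, mul_pow]
    field_simp
  have hs1 : 2 * N * s ≤ 1 := by
    have : (2 * N * s) ^ d ≤ 1 := by
      rw [mul_pow, hsd, mul_div_assoc', div_le_one hn0]
      nlinarith
    exact (pow_le_one_iff_of_nonneg (by positivity) hd).1 this
  set m := ⌊1 / (2 * N * s)⌋₊ with hm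
  have hx1 : 1 ≤ 1 / (2 * N * s) := by rwa [le_div_iff₀ (by positivity), one_mul]
  have hm1 : 1 ≤ m := Nat.le_floor (by simpa using hx1)
  have hmle : m * (2 * N * s) ≤ 1 := by
    rw [← le_div_iff₀ (by positivity)]
    exact Nat.floor_le (by positivity)
  have hmge : 1 / (4 * N * s) ≤ m := by
    have h1 : 1 / (2 * N * s) < m + 1 := Nat.lt_floor_add_one _
    have h2 : (1 : ℝ) ≤ m := by exact_mod_cast hm1
    have h3 : 1 / (4 * N * s) = 1 / (2 * N * s) / 2 := by field_simp; norm_num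
    rw [h3]
    linarith
  have : NeZero m := ⟨by omega⟩
  let ι := {c // c ∈ window d N}
  let J := Fin d → Fin m
  have hne : Nonempty ι := ⟨⟨fun _ => 0, mem_window.2 fun i => by constructor <;> omega⟩⟩
  have hcard : Fintype.card ι = (2 * N) ^ d := by
    rw [Fintype.card_coe, card_window]
  have hcardJ : Fintype.card J = m ^ d := by simp [J]
  -- Window `j` is centred at the grid vertex `(2 j + 1) N`, so along axis `i` it occupies the cell
  -- indices from `2 N j i` to `2 N (j i + 1) - 1`. Different windows are thus disjoint and all lie
  -- in the cube.
  let idx : J → ι → Fin d → ℤ := fun j c i => (2 * (j i : ℤ) + 1) * N + c.1 i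
  let Q : J → ι → Set (EuclideanSpace ℝ (Fin d)) := fun j c => {x | cell s x = idx j c}
  have hinj : ∀ i j a b, (i, a) ≠ (j, b) → idx i a ≠ idx j b := by
    intro i j a b hne heq
    have hk : ∀ t, i t = j t ∧ a.1 t = b.1 t := by
      intro t
      have h := congrFun heq t
      simp only [idx] at h
      have ha := mem_window.1 a.2 t
      have hb := mem_window.1 b.2 t
      have hNz : (0 : ℤ) < N := by exact_mod_cast Nat.pos_of_ne_zero hN
      have h1 : ((i t : ℕ) : ℤ) = (j t : ℕ) := by
        by_contra hij
        rcases lt_or_gt_of_ne hij with hlt | hlt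
        · have : ((i t : ℕ) : ℤ) + 1 ≤ (j t : ℕ) := hlt
          nlinarith
        · have : ((j t : ℕ) : ℤ) + 1 ≤ (i t : ℕ) := hlt
          nlinarith
      refine ⟨Fin.ext (by exact_mod_cast h1), ?_⟩
      rw [h1] at h
      linarith
    apply hne
    rw [Prod.mk.injEq]
    exact ⟨funext fun t => (hk t).1, Subtype.ext (funext fun t => (hk t).2)⟩
  have hsub : ∀ j c, Q j c ⊆ unitCube d := by
    intro j c x hx t
    have h := (cell_eq_iff hs0).1 hx t
    have hc := mem_window.1 c.2 t
    have h0 : (0 : ℤ) ≤ idx j c t := by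
      simp only [idx]
      have : (0 : ℤ) ≤ (j t : ℕ) := by positivity
      nlinarith
    have h1 : idx j c t + 1 ≤ 2 * m * N := by
      simp only [idx]
      have : ((j t : ℕ) : ℤ) + 1 ≤ m := by exact_mod_cast (j t).2
      have hNz : (0 : ℤ) < N := by exact_mod_cast Nat.pos_of_ne_zero hN
      nlinarith
    have h0' : (0 : ℝ) ≤ idx j c t := by exact_mod_cast h0
    have h1' : (idx j c t : ℝ) + 1 ≤ 2 * m * N := by exact_mod_cast h1
    constructor
    · exact le_trans (by positivity) h.1
    · refine h.2.le.trans ((mul_le_mul_of_nonneg_right h1' hs0.le).trans ?_)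
      linarith
  have hvol : ∀ j c, (cubeUniform d).real (Q j c) = a / n := by
    intro j c
    rw [Measure.real, cubeUniform, Measure.restrict_apply (measurableSet_cell hs0 _),
      Set.inter_eq_left.2 (hsub j c), volume_cell hs0, ENNReal.toReal_ofReal (by positivity), hsd]
  have hbound := real_no_window_le (μ := cubeUniform d) (n := n) (ι := ι) (J := J) ha1
    (l := fun c => l c.1) (fun c => hl _) (fun c => hl2 _)
    (by rw [hcard]; push_cast; exact hn) Q
    (fun i j a b hab => Set.disjoint_left.2 fun x hx hx' => hinj i j a b hab (hx.symm.trans hx'))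
    (fun j c => measurableSet_cell hs0 _) hvol
  rw [hcard, hcardJ] at hbound
  push_cast at hbound
  have hsum : ∑ c : ι, (l c.1 - 1) ^ 2 = ∑ c ∈ window d N, (l c - 1) ^ 2 :=
    Finset.sum_coe_sort (window d N) fun c => (l c - 1) ^ 2
  rw [hsum] at hbound
  set E : J → Set (Fin n → EuclideanSpace ℝ (Fin d)) :=
    fun j => countEvent n (Q j) fun c => ⌊l c.1 * a⌋₊ with hE
  have hEm : MeasurableSet (⋂ j, (E j)ᶜ) := MeasurableSet.iInter fun j =>
    (measurableSet_countEvent (fun a b hab => Set.disjoint_left.2 fun x hx hx' =>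
      hinj j j a b (by simpa using hab) (hx.symm.trans hx'))
      (fun c => measurableSet_cell hs0 _) _).compl
  have hgood : (⋂ j, (E j)ᶜ)ᶜ ⊆ {X | HasPattern N η l a r X} := by
    intro X hX
    simp only [Set.mem_compl_iff, Set.mem_iInter, not_forall, not_not] at hX
    obtain ⟨j, hj⟩ := hX
    refine ⟨WithLp.toLp 2 fun i => (2 * ((j i : ℕ) : ℝ) + 1) * N * s, fun c hc => ?_⟩
    refine Eq.trans ?_ (hj ⟨c, hc⟩)
    congr 1
    ext i
    simp only [Set.mem_ofPred_eq, Q, funext_iff]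
    refine forall_congr' fun t => ?_
    have : (r⁻¹ • (X i - WithLp.toLp 2 fun i => (2 * ((j i : ℕ) : ℝ) + 1) * N * s)) t / η
        = X i t / s - (((2 * ((j t : ℕ) : ℤ) + 1) * N : ℤ) : ℝ) := by
      simp only [PiLp.smul_apply, PiLp.sub_apply, smul_eq_mul]
      push_cast
      rw [hs]
      field_simp
    simp only [cell, idx]
    rw [this, Int.floor_sub_intCast]
    constructor <;> intro h <;> linarith
  -- `HasPattern` allows an arbitrary centre; only an inclusion of a measurable event is used, so
  -- its own measurability is not needed.
  refine le_trans ?_ (measure_mono hgood)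
  rw [← ofReal_measureReal (measure_ne_top _ _), measureReal_compl hEm, probReal_univ]
  apply ENNReal.ofReal_le_ofReal
  refine sub_le_sub_left (hbound.trans ?_) 1
  gcongr
  have : n / ((4 * N : ℝ) ^ d * a) = (1 / (4 * N * s)) ^ d := by
    rw [div_pow, mul_pow (4 * N : ℝ), hsd, one_pow]
    field_simp
  rw [this]
  gcongr

/-- The expected number of good windows, `n / log n` times `n^(-(1 - δ))` up to powers of `log n`,
grows like `n^δ` up to such powers. The second summand is the correlation error, of order `(log n)^2
/ n`. -/
lemma tendsto_error {D C A c δ : ℝ} (hC : 0 < C) (hc : 0 < c) (hδ : 0 < δ) (M : ℕ) (hD : 0 < D) :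
    Tendsto (fun n : ℕ => (n / (c * (C * Real.log n)) * (Real.exp (-((1 - δ) * Real.log n)) *
        (D / (2 * (Real.exp 1 * (2 * (C * Real.log n) + 1)) ^ M))))⁻¹ +
      8 * (A * (C * Real.log n)) ^ 2 / n) atTop (𝓝 0) := by
  have hlog : Tendsto (fun n : ℕ => Real.log n) atTop atTop :=
    Real.tendsto_log_atTop.comp tendsto_natCast_atTop_atTop
  have hg : Tendsto (fun x : ℝ =>
      2 * c * C * (Real.exp 1 * (2 * C + 1)) ^ M / D * (x ^ ((M + 1 : ℕ) : ℝ) * Real.exp (-δ * x)) +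
      8 * (A * C) ^ 2 * (x ^ ((2 : ℕ) : ℝ) * Real.exp (-1 * x))) atTop (𝓝 0) := by
    have h1 := (tendsto_rpow_mul_exp_neg_mul_atTop_nhds_zero ((M + 1 : ℕ) : ℝ) δ hδ).const_mul
      (2 * c * C * (Real.exp 1 * (2 * C + 1)) ^ M / D)
    have h2 := (tendsto_rpow_mul_exp_neg_mul_atTop_nhds_zero ((2 : ℕ) : ℝ) 1 one_pos).const_mul
      (8 * (A * C) ^ 2)
    simpa using h1.add h2
  refine squeeze_zero' ?_ ?_ (hg.comp hlog)
  · filter_upwards [hlog.eventually_ge_atTop 1] with n hL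
    positivity
  · filter_upwards [hlog.eventually_ge_atTop 1, eventually_ge_atTop 1] with n hL hn
    have hn0 : (0 : ℝ) < n := by exact_mod_cast hn
    simp only [Function.comp_apply, Real.rpow_natCast]
    set L := Real.log n with hLdef
    have hnL : (n : ℝ) = Real.exp L := (Real.exp_log hn0).symm
    refine add_le_add ?_ (le_of_eq ?_)
    · have e1 : (n / (c * (C * L)) * (Real.exp (-((1 - δ) * L)) *
          (D / (2 * (Real.exp 1 * (2 * (C * L) + 1)) ^ M))))⁻¹ =
          2 * c * C / D * (L * (Real.exp 1 * (2 * (C * L) + 1)) ^ M * Real.exp (-δ * L)) := by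
        have e2 : Real.exp L * Real.exp (-((1 - δ) * L)) * Real.exp (-δ * L) = 1 := by
          rw [← Real.exp_add, ← Real.exp_add, Real.exp_eq_one_iff]
          ring
        rw [hnL]
        refine inv_eq_of_mul_eq_one_right ?_
        calc _ = Real.exp L * Real.exp (-((1 - δ) * L)) * Real.exp (-δ * L) := by
              field_simp
          _ = 1 := e2
      rw [e1]
      have e3 : L * (Real.exp 1 * (2 * (C * L) + 1)) ^ M ≤
          (Real.exp 1 * (2 * C + 1)) ^ M * L ^ (M + 1) := by
        calc L * (Real.exp 1 * (2 * (C * L) + 1)) ^ M ≤ L * (Real.exp 1 * (2 * C + 1) * L) ^ M := by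
              rw [mul_assoc (Real.exp 1)]
              gcongr
              nlinarith
          _ = _ := by rw [mul_pow]; ring
      calc _ ≤ 2 * c * C / D *
            ((Real.exp 1 * (2 * C + 1)) ^ M * L ^ (M + 1) * Real.exp (-δ * L)) := by gcongr
        _ = _ := by ring
    · rw [hnL, neg_one_mul, Real.exp_neg]
      ring

/-- The last condition on `r` says that the cost of the profile stays below the logarithm of the
number of windows by a fixed proportion. The lower bound on `n * r^d` makes the mean of a cell at
least `1`, and the upper bound keeps all correction factors polylogarithmic. -/
theorem tendsto_hasPattern {d N : ℕ} (hd : d ≠ 0) (hN : N ≠ 0) {η : ℝ} (hη : 0 < η)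
    {l : (Fin d → ℤ) → ℝ} (hl : ∀ c, 0 ≤ l c) (hl2 : ∀ c, l c ≤ 2) {r : ℕ → ℝ} {c₀ C₀ δ : ℝ}
    (hc₀ : 0 < c₀) (hC₀ : 0 < C₀) (hδ : 0 < δ)
    (hr : ∀ᶠ n : ℕ in atTop, 0 < r n ∧ c₀ * Real.log n ≤ n * r n ^ d ∧
      n * r n ^ d ≤ C₀ * Real.log n ∧
      (η ^ d * ∑ c ∈ window d N, (l c - 1) ^ 2) * (n * r n ^ d) ≤ (1 - δ) * Real.log n) :
    Tendsto (fun n => pointsLaw d n {X | HasPattern N η l (η ^ d * (n * r n ^ d)) (r n) X})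
      atTop (𝓝 1) := by
  have hlog : Tendsto (fun n : ℕ => Real.log n) atTop atTop :=
    Real.tendsto_log_atTop.comp tendsto_natCast_atTop_atTop
  have hN0 : (0 : ℝ) < N := by exact_mod_cast Nat.pos_of_ne_zero hN
  have herr := tendsto_error (A := (2 * N : ℝ) ^ d) (c := (4 * N : ℝ) ^ d) (C := η ^ d * C₀)
    (D := Real.exp (-(1 + 2 * (2 * N : ℝ) ^ d))) (by positivity) (by positivity) hδ
    ((2 * N) ^ d) (by positivity)
  have hlim := ENNReal.tendsto_ofReal (herr.const_sub 1)
  rw [sub_zero, ENNReal.ofReal_one] at hlim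
  refine tendsto_of_tendsto_of_tendsto_of_le_of_le' hlim tendsto_const_nhds ?_
    (Eventually.of_forall fun n => prob_le_one)
  filter_upwards [hr, hlog.eventually_ge_atTop 1, hlog.eventually_ge_atTop (1 / (η ^ d * c₀)),
    herr.eventually_le_const one_pos, eventually_ge_atTop 1] with n h hL hL' hle hn
  obtain ⟨hr0, h1, h2, h3⟩ := h
  have hn0 : (0 : ℝ) < n := by exact_mod_cast hn
  have hηd : 0 < η ^ d := by positivity
  set L := Real.log n with hLdef
  set a := η ^ d * (n * r n ^ d) with ha
  have ha1 : 1 ≤ a := by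
    rw [div_le_iff₀ (by positivity)] at hL'
    calc 1 ≤ L * (η ^ d * c₀) := hL'
      _ = η ^ d * (c₀ * L) := by ring
      _ ≤ a := by rw [ha]; gcongr
  have haC : a ≤ η ^ d * C₀ * L := by
    rw [ha, mul_assoc]
    gcongr
  have hn8 : 8 * ((2 * N : ℝ) ^ d * a) ^ 2 ≤ n := by
    have h4 : 8 * ((2 * N : ℝ) ^ d * (η ^ d * C₀ * L)) ^ 2 / n ≤ 1 :=
      le_trans (le_add_of_nonneg_left (by positivity)) hle
    rw [div_le_one hn0] at h4
    refine le_trans ?_ h4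
    gcongr
  refine le_trans ?_ (ofReal_le_pointsLaw_hasPattern hd hN hη hr0 hl hl2 ha ha1 hn8)
  apply ENNReal.ofReal_le_ofReal
  apply sub_le_sub_left
  have h5 : a * ∑ c ∈ window d N, (l c - 1) ^ 2 ≤ (1 - δ) * L := by
    refine le_trans (le_of_eq ?_) h3
    rw [ha]
    ring
  gcongr

/-! ### From cuts to disconnected subgraphs. -/

/-- A point, in units of the radius, that lies in no cell of the window with density zero. -/
def Occupied {d : ℕ} (N : ℕ) (η : ℝ) (l : (Fin d → ℤ) → ℝ) (y : EuclideanSpace ℝ (Fin d)) : Prop :=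
  cell η y ∈ window d N → l (cell η y) ≠ 0

/-- A region `A` such that each point has, at the densities `l`, a proportion of more than
`1 / 2 + ε` of its neighbourhood on its own side of `A`. -/
structure IsCut {d : ℕ} (N : ℕ) (η : ℝ) (l : (Fin d → ℤ) → ℝ)
    (A : Set (EuclideanSpace ℝ (Fin d))) (ε θ : ℝ) : Prop where
  inside : ∃ c ∈ window d N, 0 < l c ∧ ∀ y, cell η y = c → y ∈ A
  outside : ∃ c ∈ window d N, 0 < l c ∧ ∀ y, cell η y = c → y ∉ A
  balance : ∀ y, Occupied N η l y →
    (∀ y', Occupied N η l y' → dist y y' ≤ 1 → (y ∈ A ↔ y' ∈ A)) ∨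
    ∃ F ⊆ window d N, ∃ I ⊆ window d N,
      (∀ y', Occupied N η l y' → dist y y' ≤ 1 → ¬ (y ∈ A ↔ y' ∈ A) → cell η y' ∈ F) ∧
      (∀ y', cell η y' ∈ I → dist y y' ≤ 1 ∧ (y ∈ A ↔ y' ∈ A)) ∧
      (1 / 2 + ε) * ∑ c ∈ F, l c + θ ≤ (1 / 2 - ε) * ∑ c ∈ I, l c

lemma degree_eq_ncard {V : Type*} [Fintype V] (G : SimpleGraph V) (v : V)
    [Fintype (G.neighborSet v)] : G.degree v = (G.neighborSet v).ncard := by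
  rw [Set.ncard_eq_toFinset_card']
  rfl

lemma ncard_setOf_mem {n : ℕ} {γ : Type*} (g : Fin n → γ) (F : Finset γ) :
    {i | g i ∈ F}.ncard = ∑ c ∈ F, {i | g i = c}.ncard := by
  classical
  have h1 : ∀ p : Fin n → Prop, {i | p i}.ncard = (Finset.univ.filter p).card := by
    intro p
    rw [← Set.ncard_coe_finset]
    simp
  simp only [h1]
  rw [Finset.card_eq_sum_card_fiberwise (f := g) (t := F) (by simp [Set.MapsTo])]
  refine Finset.sum_congr rfl fun c hc => ?_
  congr 1
  ext i
  simp only [Finset.mem_filter, Finset.mem_univ, true_and, and_iff_right_iff_imp]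
  rintro rfl
  exact hc

/-- `H` keeps the edges that do not cross the boundary of `A`. Rounding loses at most one point per
cell, and `v` itself may be counted in `I`; the slack `a * θ ≥ card + 1` absorbs both. A cell of
density zero has `⌊0⌋ = 0` points, so every vertex is `Occupied`, and `hal` puts a vertex into each
cell of positive density, hence on each side of `A`. -/
theorem exists_disconnected_of_hasPattern {d n N : ℕ} {η : ℝ} {l : (Fin d → ℤ) → ℝ}
    (hl : ∀ c, 0 ≤ l c) {A : Set (EuclideanSpace ℝ (Fin d))} {ε θ : ℝ} (hε : 0 ≤ ε)
    (hε2 : ε ≤ 1 / 2) (hcut : IsCut N η l A ε θ) {a r : ℝ} (hr : 0 < r) (ha : 0 ≤ a)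
    (haθ : (window d N).card + 1 ≤ a * θ)
    (hal : ∀ c ∈ window d N, 0 < l c → 1 ≤ l c * a)
    {X : Fin n → EuclideanSpace ℝ (Fin d)} (hX : HasPattern N η l a r X) :
    ∃ H, IsAlphaSubgraph (1 / 2 + ε) H (geomGraph X r) ∧ ¬ H.Connected := by
  obtain ⟨z, hz⟩ := hX
  set Y : Fin n → EuclideanSpace ℝ (Fin d) := fun i => r⁻¹ • (X i - z) with hY
  have hdist : ∀ i j, dist (X i) (X j) ≤ r ↔ dist (Y i) (Y j) ≤ 1 := by
    intro i j
    simp only [hY]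
    rw [dist_smul₀, dist_sub_right, Real.norm_of_nonneg (inv_nonneg.2 hr.le),
      inv_mul_le_iff₀ hr, mul_one]
  have hpos : ∀ c ∈ window d N, 0 < l c → ∃ i, cell η (Y i) = c := by
    intro c hc hlc
    have h1 : {i | cell η (Y i) = c}.ncard ≠ 0 := by
      rw [hz c hc]
      exact (Nat.floor_pos.2 (hal c hc hlc)).ne'
    obtain ⟨i, hi⟩ := Set.nonempty_of_ncard_ne_zero h1
    exact ⟨i, hi⟩
  have hocc : ∀ i, Occupied N η l (Y i) := by
    intro i hi h0
    have h1 := hz _ hi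
    rw [h0, zero_mul, Nat.floor_zero, Set.ncard_eq_zero] at h1
    exact Set.eq_empty_iff_forall_notMem.1 h1 i rfl
  let H : SimpleGraph (Fin n) :=
    { Adj := fun i j => (geomGraph X r).Adj i j ∧ (Y i ∈ A ↔ Y j ∈ A)
      symm := ⟨fun i j h => ⟨h.1.symm, h.2.symm⟩⟩
      loopless := ⟨fun i h => (geomGraph X r).loopless.irrefl i h.1⟩ }
  refine ⟨H, ⟨fun i j h => h.1, fun v => ?_⟩, ?_⟩
  · rw [degree_eq_ncard, degree_eq_ncard]
    set x : ℝ := ((H.neighborSet v).ncard : ℝ) with hx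
    have hx0 : 0 ≤ x := by positivity
    set cross : Set (Fin n) := {u | (geomGraph X r).Adj v u ∧ ¬ (Y v ∈ A ↔ Y u ∈ A)} with hcross
    have hdeg : (((geomGraph X r).neighborSet v).ncard : ℝ) ≤ x + cross.ncard := by
      have hsub : (geomGraph X r).neighborSet v ⊆ H.neighborSet v ∪ cross := by
        intro u hu
        by_cases h : Y v ∈ A ↔ Y u ∈ A
        · exact Or.inl ⟨hu, h⟩
        · exact Or.inr ⟨hu, h⟩
      have := (Set.ncard_le_ncard hsub).trans (Set.ncard_union_le _ _)
      rw [hx]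
      exact_mod_cast this
    suffices h : (1 / 2 + ε) * cross.ncard ≤ (1 / 2 - ε) * x by
      have := mul_le_mul_of_nonneg_left hdeg (by linarith : 0 ≤ 1 / 2 + ε)
      linarith
    rcases hcut.balance (Y v) (hocc v) with h | ⟨F, hF, I, hI, h1, h2, h3⟩
    · have : cross = ∅ := by
        refine Set.eq_empty_iff_forall_notMem.2 fun u hu => hu.2 ?_
        exact h _ (hocc u) ((hdist _ _).1 hu.1.2)
      rw [this, Set.ncard_empty]
      have : 0 ≤ 1 / 2 - ε := by linarith
      simpa using mul_nonneg this hx0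
    · have hc : (cross.ncard : ℝ) ≤ a * ∑ c ∈ F, l c := by
        have hsub : cross ⊆ {i | cell η (Y i) ∈ F} := fun u hu =>
          h1 _ (hocc u) ((hdist _ _).1 hu.1.2) hu.2
        have h4 := Set.ncard_le_ncard hsub
        rw [ncard_setOf_mem] at h4
        have h5 : (cross.ncard : ℝ) ≤ ∑ c ∈ F, ({i | cell η (Y i) = c}.ncard : ℝ) := by
          exact_mod_cast h4
        refine h5.trans ?_
        rw [Finset.mul_sum]
        refine Finset.sum_le_sum fun c hc => ?_
        rw [hz c (hF hc), mul_comm a]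
        exact Nat.floor_le (mul_nonneg (hl c) ha)
      have hs : a * ∑ c ∈ I, l c - (window d N).card ≤ x + 1 := by
        have hsub : {i | cell η (Y i) ∈ I} ⊆ H.neighborSet v ∪ {v} := by
          intro u hu
          by_cases huv : u = v
          · exact Or.inr huv
          · obtain ⟨h4, h5⟩ := h2 _ hu
            exact Or.inl ⟨⟨fun h => huv h.symm, (hdist _ _).2 h4⟩, h5⟩
        have h4 := (Set.ncard_le_ncard hsub).trans (Set.ncard_union_le _ _)
        rw [ncard_setOf_mem, Set.ncard_singleton] at h4
        have h5 : ∑ c ∈ I, ({i | cell η (Y i) = c}.ncard : ℝ) ≤ x + 1 := by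
          rw [hx]
          exact_mod_cast h4
        refine le_trans ?_ h5
        have h6 : a * ∑ c ∈ I, l c - I.card = ∑ c ∈ I, (l c * a - 1) := by
          rw [Finset.sum_sub_distrib, Finset.mul_sum]
          simp [mul_comm]
        have h7 : (I.card : ℝ) ≤ (window d N).card := by exact_mod_cast Finset.card_le_card hI
        refine (sub_le_sub_left h7 _).trans ?_
        rw [h6]
        refine Finset.sum_le_sum fun c hc => ?_
        rw [hz c (hI hc)]
        exact (Nat.sub_one_lt_floor _).le
      have h8 := mul_le_mul_of_nonneg_left h3 ha
      have h9 := mul_le_mul_of_nonneg_left hc (by linarith : 0 ≤ 1 / 2 + ε)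
      have h10 := mul_le_mul_of_nonneg_left hs (by linarith : 0 ≤ 1 / 2 - ε)
      have h11 : (1 / 2 - ε) * ((window d N).card + 1 : ℝ) ≤ (window d N).card + 1 := by
        have : (0 : ℝ) ≤ (window d N).card + 1 := by positivity
        nlinarith
      linarith
  · intro hconn
    have hreach : ∀ u v, H.Reachable u v → (Y u ∈ A ↔ Y v ∈ A) := by
      rintro u v ⟨p⟩
      induction p with
      | nil => rfl
      | cons h _ ih => exact h.2.trans ih
    obtain ⟨c, hc, hlc, hcA⟩ := hcut.inside
    obtain ⟨c', hc', hlc', hcA'⟩ := hcut.outside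
    obtain ⟨i, hi⟩ := hpos c hc hlc
    obtain ⟨j, hj⟩ := hpos c' hc' hlc'
    exact hcA' _ hj ((hreach i j (hconn.preconnected i j)).1 (hcA _ hi))

/-- As `n * r^d ≥ c₀ * log n` tends to infinity, the mean of a cell eventually exceeds every
constant that the deterministic statement asks for. -/
theorem aas_of_isCut {d N : ℕ} (hd : d ≠ 0) (hN : N ≠ 0) {η : ℝ} (hη : 0 < η)
    {l : (Fin d → ℤ) → ℝ} (hl : ∀ c, 0 ≤ l c) (hl2 : ∀ c, l c ≤ 2)
    {A : Set (EuclideanSpace ℝ (Fin d))} {ε θ : ℝ} (hε : 0 ≤ ε) (hε2 : ε ≤ 1 / 2) (hθ : 0 < θ)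
    (hcut : IsCut N η l A ε θ) {r : ℕ → ℝ} {c₀ C₀ δ : ℝ}
    (hc₀ : 0 < c₀) (hC₀ : 0 < C₀) (hδ : 0 < δ)
    (hr : ∀ᶠ n : ℕ in atTop, 0 < r n ∧ c₀ * Real.log n ≤ n * r n ^ d ∧
      n * r n ^ d ≤ C₀ * Real.log n ∧
      (η ^ d * ∑ c ∈ window d N, (l c - 1) ^ 2) * (n * r n ^ d) ≤ (1 - δ) * Real.log n) :
    AAS d r fun _ G => ∃ H, IsAlphaSubgraph (1 / 2 + ε) H G ∧ ¬ H.Connected := by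
  have hlog : Tendsto (fun n : ℕ => Real.log n) atTop atTop :=
    Real.tendsto_log_atTop.comp tendsto_natCast_atTop_atTop
  have hηd : 0 < η ^ d := by positivity
  have hmain : Tendsto (fun n : ℕ => η ^ d * (c₀ * Real.log n)) atTop atTop :=
    (hlog.const_mul_atTop hc₀).const_mul_atTop hηd
  refine tendsto_of_tendsto_of_tendsto_of_le_of_le'
    (tendsto_hasPattern hd hN hη hl hl2 hc₀ hC₀ hδ hr) tendsto_const_nhds ?_
    (Eventually.of_forall fun n => prob_le_one)
  have hev : ∀ᶠ n : ℕ in atTop, ∀ c ∈ window d N, 0 < l c →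
      1 ≤ l c * (η ^ d * (c₀ * Real.log n)) := by
    rw [Filter.eventually_all_finset]
    intro c _
    by_cases h : 0 < l c
    · filter_upwards [(hmain.const_mul_atTop h).eventually_ge_atTop 1] with n hn _ using hn
    · exact Eventually.of_forall fun n h' => absurd h' h
  filter_upwards [hr, hev, (hmain.atTop_mul_const hθ).eventually_ge_atTop ((window d N).card + 1),
    hlog.eventually_ge_atTop 0] with n h1 h2 h3 h4
  obtain ⟨hr0, h5, -, -⟩ := h1
  have hle : η ^ d * (c₀ * Real.log n) ≤ η ^ d * (n * r n ^ d) := by gcongr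
  refine measure_mono fun X hX => ?_
  refine exists_disconnected_of_hasPattern hl hε hε2 hcut hr0 (by positivity) ?_ ?_ hX
  · exact h3.trans (by gcongr)
  · intro c hc hlc
    exact (h2 c hc hlc).trans (by gcongr)

lemma IsAlphaSubgraph.eq_of_one {V : Type*} [Fintype V] {H G : SimpleGraph V}
    (h : IsAlphaSubgraph 1 H G) : H = G := by
  refine le_antisymm h.1 fun u v huv => ?_
  have h1 := h.2 u
  rw [degree_eq_ncard, degree_eq_ncard, one_mul] at h1
  have h2 : H.neighborSet u ⊆ G.neighborSet u := fun w hw => h.1 hw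
  have h3 := Set.eq_of_subset_of_ncard_le h2 (by exact_mod_cast h1)
  have h4 : v ∈ H.neighborSet u := by
    rw [h3]
    exact huv
  exact h4

/-- For small radii it is enough that the graph itself is disconnected, which is monotone in the
radius. -/
theorem aas_of_aas_max {d : ℕ} {r r₀ : ℕ → ℝ} {ε : ℝ} (hε2 : ε ≤ 1 / 2)
    (h : AAS d (fun n => max (r n) (r₀ n))
      fun _ G => ∃ H, IsAlphaSubgraph (1 / 2 + ε) H G ∧ ¬ H.Connected)
    (h₀ : AAS d r₀ fun _ G => ∃ H, IsAlphaSubgraph (1 / 2 + 1 / 2) H G ∧ ¬ H.Connected) :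
    AAS d r fun _ G => ∃ H, IsAlphaSubgraph (1 / 2 + ε) H G ∧ ¬ H.Connected := by
  -- Which of the two radii is larger may change with `n`, so the probability is bounded below by
  -- the minimum of both.
  have hmin := Tendsto.min h h₀
  rw [min_self] at hmin
  refine tendsto_of_tendsto_of_tendsto_of_le_of_le hmin tendsto_const_nhds ?_
    (fun n => prob_le_one)
  intro n
  rcases le_total (r₀ n) (r n) with hle | hle
  · refine (min_le_left _ _).trans (le_of_eq ?_)
    simp only [max_eq_left hle]
  · refine (min_le_right _ _).trans (measure_mono ?_)
    rintro X ⟨H, hH, hconn⟩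
    have h1 : (1 / 2 + 1 / 2 : ℝ) = 1 := by norm_num
    rw [h1] at hH
    have hHG := hH.eq_of_one
    subst hHG
    refine ⟨geomGraph X (r n), ⟨le_rfl, fun v => ?_⟩, fun hc => hconn (hc.mono ?_)⟩
    · exact mul_le_of_le_one_left (by positivity) (by linarith)
    · exact fun i j hij => ⟨hij.1, hij.2.trans hle⟩

/-! ### The line: an empty gap. -/

/-- The densities of a gap of `G` cells on the line. -/
noncomputable def lineDensity (G : ℕ) (c : Fin 1 → ℤ) : ℝ :=
  if 0 ≤ c 0 ∧ c 0 < G then 0 else 1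

lemma card_window_filter {N : ℕ} {u v : ℤ} (hu : -(N : ℤ) ≤ u) (hv : v ≤ N) :
    ((window 1 N).filter fun c => u ≤ c 0 ∧ c 0 < v).card = (v - u).toNat := by
  rw [← Int.card_Ico, ← Finset.card_image_of_injective (Finset.Ico u v)
    (f := fun t : ℤ => fun _ : Fin 1 => t) (fun a b h => congrFun h 0)]
  congr 1
  ext c
  simp only [Finset.mem_filter, mem_window, Finset.mem_image, Finset.mem_Ico, Fin.forall_fin_one]
  constructor
  · rintro ⟨-, h⟩
    exact ⟨c 0, h, funext fun i => by rw [Subsingleton.elim i 0]⟩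
  · rintro ⟨t, h, rfl⟩
    exact ⟨⟨hu.trans h.1, h.2.trans_le hv⟩, h⟩

lemma dist_line (y y' : EuclideanSpace ℝ (Fin 1)) : dist y y' = |y 0 - y' 0| := by
  rw [EuclideanSpace.dist_eq, Fin.sum_univ_one, Real.sqrt_sq dist_nonneg, Real.dist_eq]

lemma sum_lineDensity_sub_one_sq {G N : ℕ} (hG : G ≤ N) :
    ∑ c ∈ window 1 N, (lineDensity G c - 1) ^ 2 = (G : ℝ) := by
  have h : ∀ c : Fin 1 → ℤ, (lineDensity G c - 1) ^ 2 = if 0 ≤ c 0 ∧ c 0 < G then (1 : ℝ) else 0 := by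
    intro c
    rw [lineDensity]
    split_ifs <;> norm_num
  simp only [h]
  rw [Finset.sum_boole, card_window_filter (by omega) (by exact_mod_cast hG)]
  simp

/-- The gap has length `G / q`, and the inequality `h` says that it exceeds `4ε / (1 + 2ε)`. A point
near the gap has `q` full cells of its own side within reach and at most `q - G` cells across, so
`θ` is the surplus `(1/2 - ε) q - (1/2 + ε) (q - G)`. If `G > q`, nothing is within reach across the
gap. -/
theorem isCut_line {q G : ℕ} (hG : G < 2 * q) {ε : ℝ} (hε : 0 < ε) (hε2 : ε ≤ 1 / 2)
    (h : 4 * ε * q < (1 + 2 * ε) * G) :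
    ∃ θ > 0, IsCut (2 * q) (1 / q) (lineDensity G) {y : EuclideanSpace ℝ (Fin 1) | y 0 < 0} ε θ := by
  have hq : 0 < q := by omega
  have hq0 : (0 : ℝ) < q := by exact_mod_cast hq
  have hη : (0 : ℝ) < 1 / q := by positivity
  have hcell : ∀ y : EuclideanSpace ℝ (Fin 1),
      (cell (1 / q : ℝ) y 0 : ℝ) ≤ y 0 * q ∧ y 0 * q < cell (1 / q : ℝ) y 0 + 1 := by
    intro y
    have h0 : y 0 / (1 / q : ℝ) = y 0 * q := by field_simp
    simp only [cell, h0]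
    exact ⟨Int.floor_le _, Int.lt_floor_add_one _⟩
  have hneg : ∀ y : EuclideanSpace ℝ (Fin 1), y 0 < 0 ↔ cell (1 / q : ℝ) y 0 < 0 := by
    intro y
    obtain ⟨h1, h2⟩ := hcell y
    constructor
    · intro hy
      have : (cell (1 / q : ℝ) y 0 : ℝ) < 0 := h1.trans_lt (mul_neg_of_neg_of_pos hy hq0)
      exact_mod_cast this
    · intro hc
      have hc' : (cell (1 / q : ℝ) y 0 : ℝ) + 1 ≤ 0 := by exact_mod_cast hc
      by_contra hy
      push Not at hy
      have := mul_nonneg hy hq0.le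
      linarith
  have hocc : ∀ y : EuclideanSpace ℝ (Fin 1), Occupied (2 * q) (1 / q : ℝ) (lineDensity G) y →
      ¬ y 0 < 0 → (G : ℤ) ≤ cell (1 / q : ℝ) y 0 := by
    intro y hy hy0
    rw [hneg, not_lt] at hy0
    by_contra hlt
    push Not at hlt
    refine hy (mem_window.2 fun i => ?_) ?_
    · rw [Subsingleton.elim i 0]
      push_cast
      constructor <;> omega
    · rw [lineDensity, if_pos ⟨hy0, hlt⟩]
  have hin : ∃ c ∈ window 1 (2 * q), 0 < lineDensity G c ∧
      ∀ y : EuclideanSpace ℝ (Fin 1), cell (1 / q : ℝ) y = c → y ∈ {y | y 0 < 0} := by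
    refine ⟨fun _ => -1, mem_window.2 fun i => by push_cast; omega, by norm_num [lineDensity], ?_⟩
    intro y hy
    rw [Set.mem_ofPred_eq, hneg, hy]
    norm_num
  have hout : ∃ c ∈ window 1 (2 * q), 0 < lineDensity G c ∧
      ∀ y : EuclideanSpace ℝ (Fin 1), cell (1 / q : ℝ) y = c → y ∉ {y | y 0 < 0} := by
    refine ⟨fun _ => G, mem_window.2 fun i => by push_cast; omega, by norm_num [lineDensity], ?_⟩
    intro y hy
    rw [Set.mem_ofPred_eq, hneg, hy]
    simp
  -- the distance across the gap
  have hcross : ∀ y y' : EuclideanSpace ℝ (Fin 1), y 0 < 0 →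
      (G : ℤ) ≤ cell (1 / q : ℝ) y' 0 → dist y y' ≤ 1 →
      y' 0 * q ≤ y 0 * q + q ∧ (G : ℝ) ≤ y' 0 * q := by
    intro y y' _ h2 h3
    rw [dist_line, abs_le] at h3
    have h2' : (G : ℝ) ≤ cell (1 / q : ℝ) y' 0 := by exact_mod_cast h2
    exact ⟨by nlinarith [h3.1], h2'.trans (hcell y').1⟩
  rcases lt_or_ge q G with hqG | hqG
  · have hqG' : (q : ℝ) < G := by exact_mod_cast hqG
    have hno : ∀ y y' : EuclideanSpace ℝ (Fin 1), y 0 < 0 →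
        (G : ℤ) ≤ cell (1 / q : ℝ) y' 0 → ¬ dist y y' ≤ 1 := by
      intro y y' h1 h2 h3
      obtain ⟨h4, h5⟩ := hcross y y' h1 h2 h3
      have := mul_neg_of_neg_of_pos h1 hq0
      linarith
    refine ⟨1, one_pos, hin, hout, fun y hy => Or.inl fun y' hy' hd => ?_⟩
    simp only [Set.mem_ofPred_eq]
    by_cases h1 : y 0 < 0 <;> by_cases h2 : y' 0 < 0
    · simp [h1, h2]
    · exact absurd hd (hno y y' h1 (hocc y' hy' h2))
    · exact absurd (dist_comm y y' ▸ hd) (hno y' y h2 (hocc y hy h1))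
    · simp [h1, h2]
  · have hqG' : (G : ℝ) ≤ q := by exact_mod_cast hqG
    refine ⟨(1 / 2 - ε) * q - (1 / 2 + ε) * (q - G), by linarith, hin, hout, fun y hy => ?_⟩
    have hsum : ∀ (F I : Finset (Fin 1 → ℤ)), F.card = q - G → I.card = q →
        (∀ c ∈ I, lineDensity G c = 1) →
        (1 / 2 + ε) * ∑ c ∈ F, lineDensity G c + ((1 / 2 - ε) * q - (1 / 2 + ε) * (q - G)) ≤
          (1 / 2 - ε) * ∑ c ∈ I, lineDensity G c := by
      intro F I hF hI hI1
      have h1 : ∑ c ∈ F, lineDensity G c ≤ q - G := by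
        have : ∑ c ∈ F, lineDensity G c ≤ ∑ c ∈ F, (1 : ℝ) := Finset.sum_le_sum fun c _ => by
          rw [lineDensity]
          split_ifs <;> norm_num
        rw [Finset.sum_const, hF, nsmul_eq_mul, mul_one, Nat.cast_sub hqG] at this
        exact this
      rw [Finset.sum_congr rfl hI1, Finset.sum_const, hI, nsmul_eq_mul, mul_one]
      have := mul_le_mul_of_nonneg_left h1 (by linarith : 0 ≤ 1 / 2 + ε)
      linarith
    obtain ⟨hy1, hy2⟩ := hcell y
    set j := cell (1 / q : ℝ) y 0 with hj
    have hnear : ∀ y' : EuclideanSpace ℝ (Fin 1), j - q + 1 ≤ cell (1 / q : ℝ) y' 0 →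
        cell (1 / q : ℝ) y' 0 < j + q → dist y y' ≤ 1 := by
      intro y' h1 h2
      have h1' : (j : ℝ) - q + 1 ≤ cell (1 / q : ℝ) y' 0 := by exact_mod_cast h1
      have h2' : (cell (1 / q : ℝ) y' 0 : ℝ) + 1 ≤ j + q := by exact_mod_cast h2
      obtain ⟨h3, h4⟩ := hcell y'
      rw [dist_line, abs_le]
      constructor
      · have : -1 * (q : ℝ) ≤ (y 0 - y' 0) * q := by linarith
        exact le_of_mul_le_mul_right this hq0
      · have : (y 0 - y' 0) * q ≤ 1 * (q : ℝ) := by linarith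
        exact le_of_mul_le_mul_right this hq0
    by_cases hy0 : y 0 < 0
    · by_cases hfar : j < -q
      · left
        intro y' hy' hd
        simp only [Set.mem_ofPred_eq, hy0, true_iff]
        by_contra h2
        obtain ⟨h3, h4⟩ := hcross y y' hy0 (hocc y' hy' h2) hd
        have : (j : ℝ) + 1 ≤ -q := by exact_mod_cast hfar
        have : (0 : ℝ) ≤ G := by positivity
        linarith
      · right
        push Not at hfar
        have hj0 : j < 0 := (hneg y).1 hy0
        -- A negative point reaches at most the cells `G, …, q - 1` beyond the gap. The `q` cells
        -- ending with its own are wholly within distance `1`, and `j ≥ -q` keeps them in the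
        -- window.
        refine ⟨(window 1 (2 * q)).filter fun c => (G : ℤ) ≤ c 0 ∧ c 0 < q, Finset.filter_subset _ _,
          (window 1 (2 * q)).filter fun c => j - q + 1 ≤ c 0 ∧ c 0 < j + 1,
          Finset.filter_subset _ _, ?_, ?_, hsum _ _ ?_ ?_ ?_⟩
        · intro y' hy' hd hne
          simp only [Set.mem_ofPred_eq, hy0, true_iff] at hne
          have h1 := hocc y' hy' hne
          obtain ⟨h3, -⟩ := hcross y y' hy0 h1 hd
          have h5 : cell (1 / q : ℝ) y' 0 < q := by
            have : (cell (1 / q : ℝ) y' 0 : ℝ) < q := by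
              have := mul_neg_of_neg_of_pos hy0 hq0
              linarith [(hcell y').1]
            exact_mod_cast this
          refine Finset.mem_filter.2 ⟨mem_window.2 fun i => ?_, h1, h5⟩
          rw [Subsingleton.elim i 0]
          push_cast
          constructor <;> omega
        · intro y' hy'
          obtain ⟨-, h1, h2⟩ := Finset.mem_filter.1 hy'
          refine ⟨hnear y' h1 (by omega), ?_⟩
          simp only [Set.mem_ofPred_eq, hy0, true_iff, hneg y']
          omega
        · rw [card_window_filter (by push_cast; omega) (by push_cast; omega)]
          omega
        · rw [card_window_filter (by push_cast; omega) (by push_cast; omega)]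
          omega
        · intro c hc
          obtain ⟨-, h1, h2⟩ := Finset.mem_filter.1 hc
          rw [lineDensity, if_neg (by omega)]
    · have hjG : (G : ℤ) ≤ j := hocc y hy hy0
      by_cases hfar : (q : ℤ) ≤ j
      · left
        intro y' hy' hd
        simp only [Set.mem_ofPred_eq, hy0, false_iff]
        intro h2
        obtain ⟨h3, h4⟩ := hcross y' y h2 hjG (dist_comm y y' ▸ hd)
        have : (q : ℝ) ≤ j := by exact_mod_cast hfar
        have := mul_neg_of_neg_of_pos h2 hq0
        linarith
      · right
        push Not at hfar
        refine ⟨(window 1 (2 * q)).filter fun c => (G : ℤ) - q ≤ c 0 ∧ c 0 < 0,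
          Finset.filter_subset _ _,
          (window 1 (2 * q)).filter fun c => j ≤ c 0 ∧ c 0 < j + q,
          Finset.filter_subset _ _, ?_, ?_, hsum _ _ ?_ ?_ ?_⟩
        · intro y' hy' hd hne
          simp only [Set.mem_ofPred_eq, hy0, false_iff, not_not] at hne
          obtain ⟨h3, h4⟩ := hcross y' y hne hjG (dist_comm y y' ▸ hd)
          have h5 : (G : ℤ) - q ≤ cell (1 / q : ℝ) y' 0 := by
            have : (G : ℝ) - q < cell (1 / q : ℝ) y' 0 + 1 := by linarith [(hcell y').2]
            have : (G : ℤ) - q < cell (1 / q : ℝ) y' 0 + 1 := by exact_mod_cast this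
            omega
          have h6 := (hneg y').1 hne
          refine Finset.mem_filter.2 ⟨mem_window.2 fun i => ?_, h5, h6⟩
          rw [Subsingleton.elim i 0]
          push_cast
          constructor <;> omega
        · intro y' hy'
          obtain ⟨-, h1, h2⟩ := Finset.mem_filter.1 hy'
          refine ⟨hnear y' (by omega) h2, ?_⟩
          simp only [Set.mem_ofPred_eq, hy0, false_iff, hneg y']
          omega
        · rw [card_window_filter (by push_cast; omega) (by push_cast; omega)]
          omega
        · rw [card_window_filter (by push_cast; omega) (by push_cast; omega)]
          omega
        · intro c hc
          obtain ⟨-, h1, h2⟩ := Finset.mem_filter.1 hc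
          rw [lineDensity, if_neg (by omega)]

/-- Any rational gap length `x = G / q` with `4ε / (1 + 2ε) < x < 4ε` works: the lower bound makes
the gap a cut, and the upper bound makes its cost at most `x / (4ε) < 1` times `log n`. -/
theorem aas_line {ε : ℝ} (hε : 0 < ε) (hε2 : ε ≤ 1 / 2) {r : ℕ → ℝ}
    (hr : ∀ᶠ n : ℕ in atTop, Real.log n / (2 * n) ≤ r n ∧ r n ≤ Real.log n / (4 * ε * n)) :
    AAS 1 r fun _ G => ∃ H, IsAlphaSubgraph (1 / 2 + ε) H G ∧ ¬ H.Connected := by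
  obtain ⟨x, hx1, hx2⟩ := exists_rat_btwn (show 4 * ε / (1 + 2 * ε) < 4 * ε by
    rw [div_lt_iff₀ (by linarith)]
    nlinarith)
  have hxpos : 0 < x := by
    have : (0 : ℝ) < x := lt_trans (by positivity) hx1
    exact_mod_cast this
  set q := x.den with hq
  set G := x.num.toNat with hG
  have hq0 : (0 : ℝ) < q := by exact_mod_cast x.den_pos
  have hGx : (x : ℝ) = G / q := by
    have h1 : (G : ℤ) = x.num := Int.toNat_of_nonneg (Rat.num_nonneg.2 hxpos.le)
    have h2 : (G : ℝ) = (x.num : ℝ) := by exact_mod_cast h1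
    rw [h2, hq]
    exact Rat.cast_def x
  rw [hGx] at hx1 hx2
  have hGq : G < 2 * q := by
    have : (G : ℝ) < 2 * q := by
      rw [div_lt_iff₀ hq0] at hx2
      nlinarith
    exact_mod_cast this
  obtain ⟨θ, hθ, hcut⟩ := isCut_line (q := q) (G := G) hGq hε hε2 (by
    rw [div_lt_div_iff₀ (by linarith) hq0] at hx1
    linarith)
  have hl0 : ∀ c, 0 ≤ lineDensity G c := fun c => by rw [lineDensity]; split_ifs <;> norm_num
  have hl2 : ∀ c, lineDensity G c ≤ 2 := fun c => by rw [lineDensity]; split_ifs <;> norm_num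
  have hlog : Tendsto (fun n : ℕ => Real.log n) atTop atTop :=
    Real.tendsto_log_atTop.comp tendsto_natCast_atTop_atTop
  refine aas_of_isCut one_ne_zero (by omega) (by positivity) hl0 hl2 hε.le hε2 hθ hcut
    (c₀ := 1 / 2) (C₀ := 1 / (4 * ε)) (δ := 1 - G / q / (4 * ε)) (by norm_num) (by positivity)
    (by rwa [sub_pos, div_lt_one (by positivity)]) ?_
  filter_upwards [hr, hlog.eventually_ge_atTop 1, eventually_ge_atTop 1] with n h hL hn
  have hn0 : (0 : ℝ) < n := by exact_mod_cast hn
  obtain ⟨h1, h2⟩ := h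
  have h4 : n * r n ≤ 1 / (4 * ε) * Real.log n := by
    calc n * r n ≤ n * (Real.log n / (4 * ε * n)) := by gcongr
      _ = _ := by field_simp
  refine ⟨lt_of_lt_of_le (by positivity) h1, ?_, by rwa [pow_one], ?_⟩
  · calc 1 / 2 * Real.log n = n * (Real.log n / (2 * n)) := by field_simp
      _ ≤ n * r n ^ 1 := by rw [pow_one]; gcongr
  · rw [sum_lineDensity_sub_one_sq hGq.le, pow_one, pow_one]
    calc 1 / (q : ℝ) * G * (n * r n) ≤ 1 / (q : ℝ) * G * (1 / (4 * ε) * Real.log n) := by gcongr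
      _ = _ := by field_simp; ring

/-- The reference radius `log n / (2n)` is the extreme case `ε = 1/2`, where the subgraph is the
graph itself; it does not exceed `log n / (4εn)`. -/
theorem aas_line_of_le {ε : ℝ} (hε : 0 < ε) (hε2 : ε ≤ 1 / 2) {r : ℕ → ℝ}
    (hr : ∀ᶠ n : ℕ in atTop, 0 < r n ∧ r n ≤ Real.log n / (4 * ε * n)) :
    AAS 1 r fun _ G => ∃ H, IsAlphaSubgraph (1 / 2 + ε) H G ∧ ¬ H.Connected := by
  refine aas_of_aas_max (r₀ := fun n => Real.log n / (2 * n)) hε2 (aas_line hε hε2 ?_)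
    (aas_line one_half_pos le_rfl (Eventually.of_forall fun n => ⟨le_rfl, le_of_eq ?_⟩))
  · filter_upwards [hr, eventually_ge_atTop 1] with n h hn
    have hn0 : (0 : ℝ) < n := by exact_mod_cast hn
    have hL : 0 ≤ Real.log n := Real.log_natCast_nonneg n
    refine ⟨le_max_right _ _, max_le h.2 ?_⟩
    gcongr
    linarith
  · norm_num

/-! ### The plane at the reference radius: an isolated cell. -/

lemma abs_sub_le_dist {d : ℕ} (x y : EuclideanSpace ℝ (Fin d)) (i : Fin d) :
    |x i - y i| ≤ dist x y := by
  rw [dist_eq_norm]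
  exact PiLp.norm_apply_le (x - y) i

/-- The densities of two single cells far apart in the plane. -/
noncomputable def isolatedDensity (c : Fin 2 → ℤ) : ℝ :=
  if c = 0 ∨ c = (fun _ => -3) then 1 else 0

/-- Every cell of the window within distance `1` of cell `0` is empty, so no edge leaves cell `0`,
whatever `ε` is. The cell `(-3, -3)` only guarantees a point on the other side. -/
lemma isCut_isolated (ε : ℝ) :
    IsCut 3 1 isolatedDensity {y : EuclideanSpace ℝ (Fin 2) | cell 1 y = 0} ε 1 := by
  have hno : ∀ y y' : EuclideanSpace ℝ (Fin 2), Occupied 3 1 isolatedDensity y' →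
      cell 1 y = 0 → cell 1 y' ≠ 0 → ¬ dist y y' ≤ 1 := by
    intro y y' hy' h h' hd
    have hy : ∀ i, 0 ≤ y i ∧ y i < 1 := by
      intro i
      have := (cell_eq_iff one_pos).1 h i
      simpa using this
    have hz : ∀ i, |y i - y' i| ≤ 1 := fun i => (abs_sub_le_dist y y' i).trans hd
    have hb : ∀ i, -2 < cell 1 y' i ∧ cell 1 y' i < 2 := by
      intro i
      obtain ⟨h1, h2⟩ := abs_le.1 (hz i)
      obtain ⟨h3, h4⟩ := hy i
      have h5 : -1 ≤ cell 1 y' i := Int.le_floor.2 (by push_cast; rw [div_one]; linarith)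
      have h6 : cell 1 y' i < 2 := Int.floor_lt.2 (by push_cast; rw [div_one]; linarith)
      omega
    refine hy' (mem_window.2 fun i => ?_) ?_
    · have := hb i
      push_cast
      omega
    · rw [isolatedDensity, if_neg]
      rintro (h0 | h0)
      · exact h' h0
      · have := hb 0
        rw [h0] at this
        norm_num at this
  refine ⟨⟨0, mem_window.2 fun i => by simp, by simp [isolatedDensity], fun y hy => hy⟩,
    ⟨fun _ => -3, mem_window.2 fun i => by simp, by simp [isolatedDensity], fun y hy h0 => ?_⟩,
    fun y hy => Or.inl fun y' hy' hd => ?_⟩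
  · rw [Set.mem_ofPred_eq, hy] at h0
    exact absurd (congrFun h0 0) (by norm_num)
  · by_cases h1 : cell 1 y = 0 <;> by_cases h2 : cell 1 y' = 0
    · simp [h1, h2]
    · exact absurd hd (hno y y' hy' h1 h2)
    · exact absurd (dist_comm y y' ▸ hd) (hno y' y hy h2 h1)
    · simp [h1, h2]

/-- Below the connectivity threshold the random geometric graph in the plane is disconnected. -/
theorem aas_isolated : AAS 2 (fun n => 1 / 10 * Real.sqrt (Real.log n / n))
    fun _ G => ∃ H, IsAlphaSubgraph (1 / 2 + 1 / 2) H G ∧ ¬ H.Connected := by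
  have hlog : Tendsto (fun n : ℕ => Real.log n) atTop atTop :=
    Real.tendsto_log_atTop.comp tendsto_natCast_atTop_atTop
  refine aas_of_isCut two_ne_zero three_ne_zero one_pos
    (fun c => by rw [isolatedDensity]; split_ifs <;> norm_num)
    (fun c => by rw [isolatedDensity]; split_ifs <;> norm_num) (by norm_num) le_rfl one_pos
    (isCut_isolated _) (c₀ := 1 / 100) (C₀ := 1) (δ := 1 / 2) (by norm_num) one_pos (by norm_num) ?_
  filter_upwards [hlog.eventually_ge_atTop 1, eventually_ge_atTop 1] with n hL hn
  have hn0 : (0 : ℝ) < n := by exact_mod_cast hn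
  have hr : n * (1 / 10 * Real.sqrt (Real.log n / n)) ^ 2 = 1 / 100 * Real.log n := by
    rw [mul_pow, Real.sq_sqrt (by positivity)]
    field_simp
    norm_num
  -- Each of the `36` cells contributes at most `1`, so with `n * r^2 = log n / 100` the cost is at
  -- most `0.36 * log n`, below the allowed half.
  have hsum : ∑ c ∈ window 2 3, (isolatedDensity c - 1) ^ 2 ≤ 36 := by
    calc ∑ c ∈ window 2 3, (isolatedDensity c - 1) ^ 2 ≤ ∑ c ∈ window 2 3, (1 : ℝ) :=
          Finset.sum_le_sum fun c _ => by rw [isolatedDensity]; split_ifs <;> norm_num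
      _ = 36 := by norm_num [card_window]
  refine ⟨by positivity, hr.ge, ?_, ?_⟩
  · rw [hr]
    linarith
  · rw [hr]
    nlinarith

/-! ### Areas of unions of cells. -/

section CellVolume

variable {d : ℕ} {η : ℝ}

lemma volume_real_setOf_cell_mem (hη : 0 < η) (F : Finset (Fin d → ℤ)) :
    volume.real {y : EuclideanSpace ℝ (Fin d) | cell η y ∈ F} = η ^ d * F.card := by
  have h : {y : EuclideanSpace ℝ (Fin d) | cell η y ∈ F} = ⋃ c ∈ F, {y | cell η y = c} := by
    ext y
    simp
  rw [h, measureReal_biUnion_finset (h := fun c _ => by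
    rw [volume_cell hη]
    exact ENNReal.ofReal_ne_top)]
  · simp only [Measure.real, volume_cell hη, ENNReal.toReal_ofReal (pow_nonneg hη.le d)]
    simp [mul_comm]
  · intro a _ b _ hab
    exact Set.disjoint_left.2 fun y hy hy' => hab (hy.symm.trans hy')
  · exact fun c _ => measurableSet_cell hη c

lemma volume_setOf_cell_mem_ne_top (hη : 0 < η) (F : Finset (Fin d → ℤ)) :
    volume {y : EuclideanSpace ℝ (Fin d) | cell η y ∈ F} ≠ ⊤ := by
  have h : {y : EuclideanSpace ℝ (Fin d) | cell η y ∈ F} = ⋃ c ∈ F, {y | cell η y = c} := by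
    ext y
    simp
  rw [h]
  refine ((measure_biUnion_finset_le _ _).trans_lt ?_).ne
  refine ENNReal.sum_lt_top.2 fun c _ => ?_
  rw [volume_cell hη]
  exact ENNReal.ofReal_lt_top

lemma pow_mul_card_le (hη : 0 < η) {F : Finset (Fin d → ℤ)} {T : Set (EuclideanSpace ℝ (Fin d))}
    (hT : volume T ≠ ⊤) (h : ∀ y, cell η y ∈ F → y ∈ T) : η ^ d * F.card ≤ volume.real T := by
  rw [← volume_real_setOf_cell_mem hη]
  exact measureReal_mono h hT

lemma le_pow_mul_card (hη : 0 < η) {F : Finset (Fin d → ℤ)} {T : Set (EuclideanSpace ℝ (Fin d))}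
    (h : ∀ y ∈ T, cell η y ∈ F) : volume.real T ≤ η ^ d * F.card := by
  rw [← volume_real_setOf_cell_mem hη]
  exact measureReal_mono h (volume_setOf_cell_mem_ne_top hη F)

lemma exists_cell_eq (hη : 0 < η) (c : Fin d → ℤ) :
    ∃ y : EuclideanSpace ℝ (Fin d), cell η y = c := by
  refine ⟨WithLp.toLp 2 fun i => c i * η, (cell_eq_iff hη).2 fun i => ⟨le_rfl, ?_⟩⟩
  simp only
  nlinarith

end CellVolume

lemma norm_sq_plane (y : EuclideanSpace ℝ (Fin 2)) : ‖y‖ ^ 2 = y 0 ^ 2 + y 1 ^ 2 := by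
  rw [EuclideanSpace.real_norm_sq_eq, Fin.sum_univ_two]

lemma dist_le_of_cell_eq {η : ℝ} (hη : 0 < η) {x y : EuclideanSpace ℝ (Fin 2)}
    (h : cell η x = cell η y) : dist x y ≤ 2 * η := by
  have h1 := (cell_eq_iff hη).1 h
  have h2 := (cell_eq_iff hη).1 (rfl : cell η y = cell η y)
  have h3 : ∀ i, (x i - y i) ^ 2 ≤ η ^ 2 := by
    intro i
    obtain ⟨h4, h5⟩ := h1 i
    obtain ⟨h6, h7⟩ := h2 i
    exact sq_le_sq' (by linarith) (by linarith)
  rw [dist_eq_norm]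
  refine abs_le_of_sq_le_sq' ?_ (by positivity) |>.2
  rw [norm_sq_plane]
  simp only [PiLp.sub_apply]
  nlinarith [h3 0, h3 1, sq_nonneg η]

lemma cell_mem_window {d N : ℕ} {η : ℝ} (hη : 0 < η) {y : EuclideanSpace ℝ (Fin d)}
    (h : ‖y‖ < N * η) : cell η y ∈ window d N := by
  refine mem_window.2 fun i => ?_
  have h1 : |y i| < N * η := (PiLp.norm_apply_le y i).trans_lt h
  obtain ⟨h2, h3⟩ := abs_lt.1 h1
  constructor
  · refine Int.le_floor.2 ?_
    rw [le_div_iff₀ hη]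
    push_cast
    linarith
  · refine Int.floor_lt.2 ?_
    rw [div_lt_iff₀ hη]
    exact_mod_cast h3

open Metric

lemma volume_real_closedBall {v : EuclideanSpace ℝ (Fin 2)} {ρ : ℝ} (hρ : 0 ≤ ρ) :
    volume.real (closedBall v ρ) = Real.pi * ρ ^ 2 := by
  rw [Measure.real, EuclideanSpace.volume_closedBall_fin_two, ENNReal.toReal_mul,
    ENNReal.toReal_pow, ENNReal.toReal_ofReal hρ, ENNReal.toReal_ofReal Real.pi_pos.le, mul_comm]

lemma volume_ne_top_of_subset_closedBall {T : Set (EuclideanSpace ℝ (Fin 2))}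
    {v : EuclideanSpace ℝ (Fin 2)} {ρ : ℝ} (h : T ⊆ closedBall v ρ) : volume T ≠ ⊤ :=
  ((measure_mono h).trans_lt measure_closedBall_lt_top).ne

lemma volume_real_closedBall_diff {v : EuclideanSpace ℝ (Fin 2)} {ρ ρ' : ℝ} (hρ : 0 ≤ ρ)
    (h : ρ ≤ ρ') :
    volume.real (closedBall v ρ' \ closedBall v ρ) = Real.pi * (ρ' ^ 2 - ρ ^ 2) := by
  rw [measureReal_sdiff (closedBall_subset_closedBall h) measurableSet_closedBall
    (h₁ := measure_closedBall_lt_top.ne), volume_real_closedBall hρ,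
    volume_real_closedBall (hρ.trans h)]
  ring

lemma volume_real_le_of_add {T T' : Set (EuclideanSpace ℝ (Fin 2))}
    (g : EuclideanSpace ℝ (Fin 2)) (hT' : volume T' ≠ ⊤) (h : ∀ y ∈ T, y + g ∈ T') :
    volume.real T ≤ volume.real T' := by
  have h1 : volume ((fun y => y + g) ⁻¹' T') = volume T' := measure_preimage_add_right _ _ _
  refine ENNReal.toReal_mono hT' ?_
  rw [← h1]
  exact measure_mono h

lemma volume_real_le_of_isometry {T T' : Set (EuclideanSpace ℝ (Fin 2))}
    (φ : EuclideanSpace ℝ (Fin 2) ≃ₗᵢ[ℝ] EuclideanSpace ℝ (Fin 2)) (hT' : volume T' ≠ ⊤)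
    (h : ∀ y ∈ T, φ y ∈ T') : volume.real T ≤ volume.real T' := by
  have h1 : volume (φ ⁻¹' T') = volume T' :=
    φ.measurePreserving.measure_preimage_equiv (f := φ.toMeasurableEquiv) T'
  refine ENNReal.toReal_mono hT' ?_
  rw [← h1]
  exact measure_mono h

/-! ### How a circle divides a unit disc. -/

/-- The area of the part of the unit disc around `v` in the disc of radius `R`. -/
noncomputable def inArea (R : ℝ) (v : EuclideanSpace ℝ (Fin 2)) : ℝ :=
  volume.real (closedBall v 1 ∩ closedBall 0 R)

/-- The area of the part of the unit disc around `v` outside the disc of radius `R`. -/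
noncomputable def outArea (R : ℝ) (v : EuclideanSpace ℝ (Fin 2)) : ℝ :=
  volume.real (closedBall v 1 \ closedBall 0 R)

section Areas

variable {R R' : ℝ} {v w : EuclideanSpace ℝ (Fin 2)}

lemma volume_inter_ne_top : volume (closedBall v 1 ∩ closedBall 0 R) ≠ ⊤ :=
  volume_ne_top_of_subset_closedBall Set.inter_subset_left

lemma volume_diff_ne_top : volume (closedBall v 1 \ closedBall 0 R) ≠ ⊤ :=
  volume_ne_top_of_subset_closedBall Set.sdiff_subset

lemma inArea_nonneg : 0 ≤ inArea R v := measureReal_nonneg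

lemma outArea_nonneg : 0 ≤ outArea R v := measureReal_nonneg

lemma exists_isometry_map (h : ‖v‖ = ‖w‖) :
    ∃ φ : EuclideanSpace ℝ (Fin 2) ≃ₗᵢ[ℝ] EuclideanSpace ℝ (Fin 2), φ v = w :=
  ⟨_, Submodule.reflection_sub h⟩

lemma inArea_le_of_norm_eq (h : ‖v‖ = ‖w‖) : inArea R v ≤ inArea R w := by
  obtain ⟨φ, rfl⟩ := exists_isometry_map h
  refine volume_real_le_of_isometry φ volume_inter_ne_top fun y hy => ?_
  simpa using hy

lemma outArea_le_of_norm_eq (h : ‖v‖ = ‖w‖) : outArea R v ≤ outArea R w := by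
  obtain ⟨φ, rfl⟩ := exists_isometry_map h
  refine volume_real_le_of_isometry φ volume_diff_ne_top fun y hy => ?_
  simpa using hy

lemma le_inner_of_dist_le {y : EuclideanSpace ℝ (Fin 2)} (h : dist y w ≤ 1) :
    inner ℝ w v - ‖v‖ ≤ inner ℝ y v := by
  have h1 := abs_real_inner_le_norm (y - w) v
  rw [inner_sub_left] at h1
  rw [dist_eq_norm] at h
  have h2 : ‖y - w‖ * ‖v‖ ≤ 1 * ‖v‖ := by gcongr
  linarith [(abs_le.1 h1).1]

/-- Translation by `-(t - 1) v` carries one region into the other. For `y` in the unit disc around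
`t v`, `⟪y, v⟫ ≥ t ‖v‖^2 - ‖v‖ ≥ (t - 1) ‖v‖^2`, using `‖v‖ ≥ 1`, so this translation does not
increase the norm of `y`. -/
lemma inArea_smul_le (hR : 0 ≤ R) (hv : 1 ≤ ‖v‖) {t : ℝ} (ht : 1 ≤ t) :
    inArea R (t • v) ≤ inArea R v := by
  refine volume_real_le_of_add (-((t - 1) • v)) volume_inter_ne_top ?_
  rintro y ⟨h1, h2⟩
  rw [mem_closedBall] at h1
  rw [mem_closedBall_zero_iff] at h2
  refine ⟨?_, ?_⟩
  · rw [mem_closedBall, dist_eq_norm]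
    rw [dist_eq_norm] at h1
    convert h1 using 2
    module
  · rw [mem_closedBall_zero_iff, ← sub_eq_add_neg]
    have h3 := le_inner_of_dist_le (v := v) h1
    rw [inner_smul_left, real_inner_self_eq_norm_sq] at h3
    simp only [conj_trivial] at h3
    refine (abs_le_of_sq_le_sq' ?_ hR).2
    rw [norm_sub_sq_real, norm_smul, inner_smul_right, Real.norm_of_nonneg (by linarith), mul_pow]
    have h4 : ‖y‖ ^ 2 ≤ R ^ 2 := by gcongr
    have h5 : (t - 1) * ‖v‖ ^ 2 ≤ 2 * inner ℝ y v := by nlinarith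
    nlinarith [mul_le_mul_of_nonneg_left h5 (by linarith : 0 ≤ t - 1)]

/-- The opposite translation: points of the unit disc around `v` have nonnegative inner product with
`v` when `‖v‖ ≥ 1`, so moving them by `(t - 1) v` does not decrease their norm. -/
lemma outArea_le_smul (hv : 1 ≤ ‖v‖) {t : ℝ} (ht : 1 ≤ t) :
    outArea R v ≤ outArea R (t • v) := by
  refine volume_real_le_of_add ((t - 1) • v) volume_diff_ne_top ?_
  rintro y ⟨h1, h2⟩
  rw [mem_closedBall] at h1
  rw [mem_closedBall_zero_iff, not_le] at h2
  refine ⟨?_, ?_⟩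
  · rw [mem_closedBall, dist_eq_norm]
    rw [dist_eq_norm] at h1
    convert h1 using 2
    module
  · rw [mem_closedBall_zero_iff, not_le]
    have h3 := le_inner_of_dist_le (v := v) h1
    rw [real_inner_self_eq_norm_sq] at h3
    refine h2.trans_le (abs_le_of_sq_le_sq' ?_ (norm_nonneg _)).2
    rw [norm_add_sq_real, inner_smul_right]
    have h5 : 0 ≤ inner ℝ y v := by nlinarith
    nlinarith [mul_nonneg (by linarith : 0 ≤ t - 1) h5, sq_nonneg ‖(t - 1) • v‖]

lemma inArea_anti (hR : 0 ≤ R) (hv : 1 ≤ ‖v‖) (hvw : ‖v‖ ≤ ‖w‖) : inArea R w ≤ inArea R v := by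
  have hv0 : ‖v‖ ≠ 0 := by linarith
  refine le_trans (inArea_le_of_norm_eq ?_) (inArea_smul_le hR hv (t := ‖w‖ / ‖v‖) ?_)
  · rw [norm_smul, Real.norm_of_nonneg (by positivity)]
    field_simp
  · rwa [le_div_iff₀ (by linarith), one_mul]

lemma outArea_mono (hv : 1 ≤ ‖v‖) (hvw : ‖v‖ ≤ ‖w‖) : outArea R v ≤ outArea R w := by
  have hv0 : ‖v‖ ≠ 0 := by linarith
  refine le_trans (outArea_le_smul hv (t := ‖w‖ / ‖v‖) ?_) (outArea_le_of_norm_eq ?_)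
  · rwa [le_div_iff₀ (by linarith), one_mul]
  · rw [norm_smul, Real.norm_of_nonneg (by positivity)]
    field_simp

lemma inArea_add_outArea_le (hRR' : R ≤ R') : inArea R v + outArea R' v ≤ Real.pi := by
  rw [inArea, outArea, ← measureReal_union (h₁ := volume_inter_ne_top) (h₂ := volume_diff_ne_top)]
  · have := volume_real_closedBall (v := v) zero_le_one
    rw [one_pow, mul_one] at this
    rw [← this]
    refine measureReal_mono (Set.union_subset Set.inter_subset_left Set.sdiff_subset)
      measure_closedBall_lt_top.ne
  · refine Set.disjoint_left.2 fun y hy hy' => hy'.2 ?_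
    exact closedBall_subset_closedBall hRR' hy.2
  · exact measurableSet_closedBall.diff measurableSet_closedBall

end Areas

/-- The first standard unit vector of the plane. -/
noncomputable def e₀ : EuclideanSpace ℝ (Fin 2) := EuclideanSpace.single 0 1

lemma norm_smul_e₀ {t : ℝ} (ht : 0 ≤ t) : ‖t • e₀‖ = t := by
  rw [norm_smul, e₀, PiLp.norm_single, norm_one, mul_one, Real.norm_of_nonneg ht]

lemma e₀_zero : e₀ 0 = 1 := by simp [e₀]

lemma e₀_one : e₀ 1 = 0 := by simp [e₀]

/-- The strictness is what leaves room for `ρ`. Translation by `h e₀` embeds the first region into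
the second and misses the ball of radius `h / 2` around `(R + 3h/2) e₀`, whose points come back to
norm at most `R + h`. -/
lemma outArea_lt {R h : ℝ} (hR : 1 ≤ R) (hh : 0 < h) (hh1 : h ≤ 1) :
    outArea (R + h) (R • e₀) < outArea (R + h) ((R + h) • e₀) := by
  set T : Set (EuclideanSpace ℝ (Fin 2)) :=
    (fun y => y + -(h • e₀)) ⁻¹' (closedBall (R • e₀) 1 \ closedBall 0 (R + h)) with hT
  have hTm : volume T = volume (closedBall (R • e₀) 1 \ closedBall 0 (R + h)) :=
    measure_preimage_add_right _ _ _
  have he : ‖h • e₀‖ = h := norm_smul_e₀ hh.le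
  have hb : 0 < volume.real (ball ((R + h + h / 2) • e₀) (h / 2)) :=
    ENNReal.toReal_pos (measure_ball_pos _ _ (by linarith)).ne' measure_ball_lt_top.ne
  have hsubT : T ⊆ closedBall ((R + h) • e₀) 1 \ closedBall 0 (R + h) := by
    rintro y ⟨h1, h2⟩
    rw [mem_closedBall, dist_eq_norm] at h1
    rw [mem_closedBall_zero_iff, not_le] at h2
    refine ⟨?_, ?_⟩
    · rw [mem_closedBall, dist_eq_norm]
      convert h1 using 2
      module
    · rw [mem_closedBall_zero_iff, not_le]
      have h3 := abs_le.1 ((PiLp.norm_apply_le (y + -(h • e₀) - R • e₀) 0).trans h1)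
      simp only [PiLp.sub_apply, PiLp.add_apply, PiLp.neg_apply, PiLp.smul_apply, e₀_zero,
        smul_eq_mul, mul_one] at h3
      refine h2.trans_le (abs_le_of_sq_le_sq' ?_ (norm_nonneg _)).2
      rw [norm_sq_plane, norm_sq_plane]
      simp only [PiLp.add_apply, PiLp.neg_apply, PiLp.smul_apply, e₀_zero, e₀_one,
        smul_eq_mul, mul_one, mul_zero, neg_zero, add_zero]
      nlinarith [h3.1]
  have hsubB : ball ((R + h + h / 2) • e₀) (h / 2) ⊆
      closedBall ((R + h) • e₀) 1 \ closedBall 0 (R + h) := by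
    intro y hy
    rw [mem_ball, dist_eq_norm] at hy
    refine ⟨?_, ?_⟩
    · rw [mem_closedBall, dist_eq_norm]
      have h1 : y - (R + h) • e₀ = (y - (R + h + h / 2) • e₀) + (h / 2) • e₀ := by module
      have h2 := norm_add_le (y - (R + h + h / 2) • e₀) ((h / 2) • e₀)
      rw [norm_smul_e₀ (by linarith)] at h2
      rw [h1]
      linarith
    · rw [mem_closedBall_zero_iff, not_le]
      have h1 := norm_sub_norm_le ((R + h + h / 2) • e₀) y
      rw [norm_smul_e₀ (by linarith), norm_sub_rev] at h1
      linarith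
  have hdisj : Disjoint T (ball ((R + h + h / 2) • e₀) (h / 2)) := by
    refine Set.disjoint_left.2 fun y hy hy' => hy.2 ?_
    rw [mem_ball, dist_eq_norm] at hy'
    rw [mem_closedBall_zero_iff]
    have h1 : y + -(h • e₀) = (y - (R + h + h / 2) • e₀) + (R + h / 2) • e₀ := by module
    have h2 := norm_add_le (y - (R + h + h / 2) • e₀) ((R + h / 2) • e₀)
    rw [norm_smul_e₀ (by linarith)] at h2
    simp only [h1]
    linarith
  have hTr : volume.real T = outArea (R + h) (R • e₀) := by
    rw [outArea, Measure.real, hTm, Measure.real]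
  have hun := measureReal_union hdisj measurableSet_ball (μ := volume)
    (h₁ := volume_ne_top_of_subset_closedBall (hsubT.trans Set.sdiff_subset))
    (h₂ := measure_ball_lt_top.ne)
  have hle : volume.real (T ∪ ball ((R + h + h / 2) • e₀) (h / 2)) ≤
      outArea (R + h) ((R + h) • e₀) :=
    measureReal_mono (Set.union_subset hsubT hsubB) volume_diff_ne_top
  linarith

/-- Half of the disc, by the symmetry `y ↦ -y`, minus a part of a `c` by `2` rectangle. -/
lemma volume_halfDisc {c : ℝ} (hc : 0 ≤ c) :
    Real.pi / 2 - 2 * c ≤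
      volume.real (closedBall (0 : EuclideanSpace ℝ (Fin 2)) 1 ∩ {y | y 0 ≤ -c}) := by
  set D := closedBall (0 : EuclideanSpace ℝ (Fin 2)) 1 with hD
  have hvD : volume.real D = Real.pi := by
    rw [hD, volume_real_closedBall zero_le_one]
    ring
  set S : Set (EuclideanSpace ℝ (Fin 2)) := (MeasurableEquiv.toLp 2 (Fin 2 → ℝ)).symm ⁻¹'
    (Set.univ.pi fun i => if i = 0 then Set.Icc (-c) 0 else Set.Icc (-1) 1) with hS
  have hSv : volume S = ENNReal.ofReal (2 * c) := by
    rw [hS, (EuclideanSpace.volume_preserving_symm_measurableEquiv_toLp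
      (Fin 2)).measure_preimage_equiv, volume_pi_pi, Fin.prod_univ_two]
    simp only [if_true, one_ne_zero, if_false, Real.volume_Icc]
    rw [← ENNReal.ofReal_mul (by linarith)]
    congr 1
    ring
  have hfin : ∀ T : Set (EuclideanSpace ℝ (Fin 2)), volume (D ∩ T) ≠ ⊤ := fun T =>
    volume_ne_top_of_subset_closedBall Set.inter_subset_left
  have h1 : volume.real D ≤ volume.real (D ∩ {y | y 0 ≤ 0}) + volume.real (D ∩ {y | 0 ≤ y 0}) := by
    refine le_trans (measureReal_mono ?_ ?_) (measureReal_union_le _ _)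
    · intro y hy
      rcases le_total (y 0) 0 with h | h
      · exact Or.inl ⟨hy, h⟩
      · exact Or.inr ⟨hy, h⟩
    · exact (measure_union_lt_top (hfin _).lt_top (hfin _).lt_top).ne
  have h2 : volume.real (D ∩ {y | 0 ≤ y 0}) ≤ volume.real (D ∩ {y | y 0 ≤ 0}) := by
    refine volume_real_le_of_isometry (LinearIsometryEquiv.neg ℝ) (hfin _) ?_
    rintro y ⟨hy, hy0⟩
    refine ⟨by simpa [hD] using hy, ?_⟩
    simpa using hy0
  have h3 : volume.real (D ∩ {y | y 0 ≤ 0}) ≤ volume.real (D ∩ {y | y 0 ≤ -c}) + 2 * c := by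
    have hS' : volume.real S = 2 * c := by
      rw [Measure.real, hSv, ENNReal.toReal_ofReal (by linarith)]
    rw [← hS']
    refine le_trans (measureReal_mono ?_ ?_) (measureReal_union_le _ _)
    · rintro y ⟨hy, hy0⟩
      rcases le_total (y 0) (-c) with h | h
      · exact Or.inl ⟨hy, h⟩
      · right
        rw [hS, Set.mem_preimage, Set.mem_univ_pi, Fin.forall_fin_two]
        rw [hD, mem_closedBall_zero_iff] at hy
        refine ⟨⟨h, hy0⟩, ?_⟩
        exact abs_le.1 ((PiLp.norm_apply_le y 1).trans hy)
    · refine (measure_union_lt_top (hfin _).lt_top ?_).ne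
      rw [hSv]
      exact ENNReal.ofReal_lt_top
  linarith

/-- Points of the unit disc around `(R + h) e₀` whose first coordinate relative to the centre is at
most `-(1/R + h)` have norm at most `R`, because `(R - 1/R)^2 + 1 ≤ R^2`. -/
lemma le_inArea {R h : ℝ} (hR : 1 ≤ R) (hh : 0 ≤ h) :
    Real.pi / 2 - 2 * (1 / R + h) ≤ inArea R ((R + h) • e₀) := by
  have hR0 : 0 < R := by linarith
  refine (volume_halfDisc (by positivity)).trans
    (volume_real_le_of_add ((R + h) • e₀) volume_inter_ne_top ?_)
  rintro y ⟨h1, h2⟩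
  refine ⟨by simpa [dist_eq_norm] using h1, ?_⟩
  rw [mem_closedBall_zero_iff] at h1 ⊢
  refine (abs_le_of_sq_le_sq' ?_ hR0.le).2
  have h3 : ‖y‖ ^ 2 ≤ 1 := by nlinarith [norm_nonneg y]
  rw [norm_sq_plane] at h3 ⊢
  simp only [PiLp.add_apply, PiLp.smul_apply, e₀_zero, e₀_one, smul_eq_mul, mul_one, mul_zero,
    add_zero]
  simp only [Set.mem_ofPred_eq] at h2
  have h4 : -1 ≤ y 0 := by nlinarith [sq_nonneg (y 1)]
  have h5 : y 1 ^ 2 ≤ 1 := by nlinarith [sq_nonneg (y 0)]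
  have h6 : (y 0 + (R + h)) ^ 2 ≤ (R - 1 / R) ^ 2 :=
    pow_le_pow_left₀ (by linarith) (by linarith) 2
  have h7 : (R - 1 / R) ^ 2 = R ^ 2 - 2 + (1 / R) ^ 2 := by field_simp; ring
  have h8 : (1 / R) ^ 2 ≤ 1 := by
    have : 1 / R ≤ 1 := by rw [div_le_one hR0]; exact hR
    exact pow_le_one₀ (by positivity) this
  linarith

/-- The offset is `2 * h` instead of `h` so that the points lie strictly outside radius `R + h`. -/
lemma le_outArea {R h : ℝ} (hh : 0 < h) :
    Real.pi / 2 - 2 * (2 * h) ≤ outArea (R + h) (R • e₀) := by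
  have h0 := volume_halfDisc (c := 2 * h) (by positivity)
  refine h0.trans (le_trans (volume_real_le_of_isometry (LinearIsometryEquiv.neg ℝ)
    (T' := closedBall 0 1 ∩ {y | 2 * h ≤ y 0})
    (volume_ne_top_of_subset_closedBall Set.inter_subset_left) ?_)
    (volume_real_le_of_add (R • e₀) volume_diff_ne_top ?_))
  · rintro y ⟨h1, h2⟩
    simp only [Set.mem_ofPred_eq] at h2
    refine ⟨by simpa using h1, ?_⟩
    simp only [Set.mem_ofPred_eq, LinearIsometryEquiv.coe_neg, PiLp.neg_apply]
    linarith
  · rintro y ⟨h1, h2⟩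
    refine ⟨by simpa [dist_eq_norm] using h1, ?_⟩
    rw [mem_closedBall_zero_iff, not_le]
    simp only [Set.mem_ofPred_eq] at h2
    have h3 := (le_abs_self _).trans (PiLp.norm_apply_le (y + R • e₀) 0)
    simp only [PiLp.add_apply, PiLp.smul_apply, e₀_zero, smul_eq_mul, mul_one] at h3
    linarith

/-- A density for the disc of radius `R` that balances the neighbourhoods of the points on both
sides of the annulus between the radii `R` and `R + h`. -/
theorem exists_balancing_density {R h : ℝ} (hR : 8 ≤ R) (hh : 0 < h) (hhR : h ≤ 1 / R) :
    ∃ ρ : ℝ, |ρ - 1| ≤ 8 / R ∧ ∃ Δ > 0,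
      (∀ v : EuclideanSpace ℝ (Fin 2), 1 ≤ ‖v‖ → ‖v‖ ≤ R →
        outArea (R + h) v + Δ ≤ ρ * inArea R v) ∧
      (∀ v : EuclideanSpace ℝ (Fin 2), R + h ≤ ‖v‖ →
        ρ * inArea R v + Δ ≤ outArea (R + h) v) := by
  have hR0 : 0 < R := by linarith
  have hR1 : 1 / R ≤ 1 / 8 := one_div_le_one_div_of_le (by norm_num) hR
  have hnR : ‖R • e₀‖ = R := norm_smul_e₀ hR0.le
  have hnR' : ‖(R + h) • e₀‖ = R + h := norm_smul_e₀ (by linarith)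
  have hI' := le_inArea (R := R) (h := h) (by linarith) hh.le
  have hO := le_outArea (R := R) (h := h) hh
  have hII' : inArea R ((R + h) • e₀) ≤ inArea R (R • e₀) :=
    inArea_anti hR0.le (by rw [hnR]; linarith) (by rw [hnR, hnR']; linarith)
  have hOO' := outArea_lt (R := R) (h := h) (by linarith) hh (by linarith)
  have hs := inArea_add_outArea_le (R := R) (R' := R + h) (v := R • e₀) (by linarith)
  have hs' := inArea_add_outArea_le (R := R) (R' := R + h) (v := (R + h) • e₀) (by linarith)
  set I := inArea R (R • e₀)
  set I' := inArea R ((R + h) • e₀)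
  set O := outArea (R + h) (R • e₀)
  set O' := outArea (R + h) ((R + h) • e₀)
  have hpi := Real.pi_gt_three
  have hIpos : 1 ≤ I' := by linarith
  -- Moving the centre outwards lowers the inner area and strictly raises the outer one. A `ρ`
  -- between the quotients favours the inside at norm `R` and the outside at norm `R + h`;
  -- monotonicity of both areas extends this to the other centres.
  have hlt : O / I < O' / I' := by
    rw [div_lt_div_iff₀ (by linarith) (by linarith)]
    nlinarith
  obtain ⟨ρ, hρ1, hρ2⟩ := exists_between hlt
  have h8 : 8 / R = 8 * (1 / R) := by ring
  rw [div_lt_iff₀ (by linarith)] at hρ1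
  rw [lt_div_iff₀ (by linarith)] at hρ2
  refine ⟨ρ, ?_, min (ρ * I - O) (O' - ρ * I'), lt_min (by linarith) (by linarith), ?_, ?_⟩
  -- `I'` and `O` are at least `π/2 - 4/R`, while `I + O` and `I' + O'` are at most `π`. Hence `O /
  -- I ≥ 1 - 8/R` and `O' / I' ≤ 1 + 8/R`.
  · rw [abs_le, h8]
    constructor
    · by_contra hcon
      push Not at hcon
      nlinarith
    · by_contra hcon
      push Not at hcon
      nlinarith
  · intro v hv1 hv2
    have h1 : I ≤ inArea R v := inArea_anti hR0.le hv1 (by rw [hnR]; exact hv2)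
    have h2 : outArea (R + h) v ≤ O := outArea_mono hv1 (by rw [hnR]; exact hv2)
    have hρ0 : 0 ≤ ρ := by
      by_contra hcon
      push Not at hcon
      have : 0 ≤ O := outArea_nonneg
      nlinarith
    have := min_le_left (ρ * I - O) (O' - ρ * I')
    nlinarith
  · intro v hv
    have h1 : inArea R v ≤ I' := inArea_anti hR0.le (by rw [hnR']; linarith) (by rw [hnR']; exact hv)
    have h2 : O' ≤ outArea (R + h) v :=
      outArea_mono (by rw [hnR']; linarith) (by rw [hnR']; exact hv)
    have hρ0 : 0 ≤ ρ := by
      by_contra hcon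
      push Not at hcon
      have : 0 ≤ O := outArea_nonneg
      nlinarith
    have := min_le_right (ρ * I - O) (O' - ρ * I')
    nlinarith

/-! ### The disc as a cut, and its cost. -/

open Classical in
/-- The densities that separate the disc of radius `R` from the rest of the plane: zero on the
cells that meet the annulus between the radii `R` and `R + h`, and `ρ` on the cells of the disc
that are close to its boundary. -/
noncomputable def discDensity (R h ρ η : ℝ) (c : Fin 2 → ℤ) : ℝ :=
  if ∀ y : EuclideanSpace ℝ (Fin 2), cell η y = c → ‖y‖ ≤ R then
    if ∀ y : EuclideanSpace ℝ (Fin 2), cell η y = c → ‖y‖ ≤ R - 4 then 1 else ρ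
  else if ∀ y : EuclideanSpace ℝ (Fin 2), cell η y = c → R + h < ‖y‖ then 1 else 0

section Disc

variable {R h ρ η : ℝ}

lemma discDensity_of_outside (hη : 0 < η) (hh : 0 ≤ h) {c : Fin 2 → ℤ}
    (hc : ∀ y : EuclideanSpace ℝ (Fin 2), cell η y = c → R + h < ‖y‖) :
    discDensity R h ρ η c = 1 := by
  obtain ⟨y, hy⟩ := exists_cell_eq hη c
  rw [discDensity, if_neg, if_pos hc]
  intro h'
  linarith [hc y hy, h' y hy]

lemma discDensity_of_inside {c : Fin 2 → ℤ}
    (hc : ∀ y : EuclideanSpace ℝ (Fin 2), cell η y = c → ‖y‖ ≤ R)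
    {y : EuclideanSpace ℝ (Fin 2)} (hy : cell η y = c) (hy' : R - 4 < ‖y‖) :
    discDensity R h ρ η c = ρ := by
  rw [discDensity, if_pos hc, if_neg]
  intro h'
  linarith [h' y hy]

lemma discDensity_nonneg (hρ : 0 ≤ ρ) (c : Fin 2 → ℤ) : 0 ≤ discDensity R h ρ η c := by
  rw [discDensity]
  split_ifs <;> linarith

lemma discDensity_le_two (hρ : ρ ≤ 2) (c : Fin 2 → ℤ) : discDensity R h ρ η c ≤ 2 := by
  rw [discDensity]
  split_ifs <;> linarith

lemma norm_le_add_of_cell_eq (hη : 0 < η) {x y : EuclideanSpace ℝ (Fin 2)}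
    (h : cell η x = cell η y) : ‖x‖ ≤ ‖y‖ + 2 * η := by
  have h1 := dist_le_of_cell_eq hη h
  rw [dist_eq_norm] at h1
  have h2 := norm_sub_norm_le x y
  linarith

/-- An occupied point lies in a cell on one of the two sides of the annulus. -/
lemma occupied_disc {N : ℕ} (hη : 0 < η) (hN : R + 4 < N * η)
    {y : EuclideanSpace ℝ (Fin 2)} (hy : Occupied N η (discDensity R h ρ η) y)
    (hyR : ‖y‖ ≤ R + 4) :
    (∀ x : EuclideanSpace ℝ (Fin 2), cell η x = cell η y → ‖x‖ ≤ R) ∨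
    (∀ x : EuclideanSpace ℝ (Fin 2), cell η x = cell η y → R + h < ‖x‖) := by
  have h1 := hy (cell_mem_window hη (by linarith))
  rw [discDensity] at h1
  split_ifs at h1 with h2 h3 h3
  · exact Or.inl h2
  · exact Or.inl h2
  · exact Or.inr h3
  · exact absurd rfl h1

lemma volume_real_le_add {S T U : Set (EuclideanSpace ℝ (Fin 2))} (hT : volume T ≠ ⊤)
    (hU : volume U ≠ ⊤) (h : S ⊆ T ∪ U) : volume.real S ≤ volume.real T + volume.real U :=
  (measureReal_mono h (measure_union_lt_top hT.lt_top hU.lt_top).ne).trans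
    (measureReal_union_le _ _)

lemma pi_mul_le {x : ℝ} (hx : 0 ≤ x) : Real.pi * x ≤ 4 * x :=
  mul_le_mul_of_nonneg_right Real.pi_le_four hx

/-- Passing from regions to unions of cells, of diameter at most `2η`, changes areas only by annuli
of width `2η` and radius `O(R)`. The error `100 R η` is a common bound for this and the next three
estimates. -/
lemma volume_enlarged_diff_le (hR : 8 ≤ R) (hη : 0 < η) (hη8 : η ≤ 1 / 8)
    (v : EuclideanSpace ℝ (Fin 2)) (R' : ℝ) :
    volume.real (closedBall v (1 + 2 * η) \ closedBall 0 R') ≤ outArea R' v + 100 * R * η := by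
  have h1 := volume_real_closedBall_diff (v := v) zero_le_one (by linarith : 1 ≤ 1 + 2 * η)
  have h2 : volume.real (closedBall v (1 + 2 * η) \ closedBall 0 R') ≤
      outArea R' v + volume.real (closedBall v (1 + 2 * η) \ closedBall v 1) := by
    refine volume_real_le_add volume_diff_ne_top
      (volume_ne_top_of_subset_closedBall Set.sdiff_subset) fun y hy => ?_
    by_cases h : y ∈ closedBall v 1
    · exact Or.inl ⟨h, hy.2⟩
    · exact Or.inr ⟨hy.1, h⟩
  have h3 := pi_mul_le (by nlinarith : 0 ≤ (1 + 2 * η) ^ 2 - 1 ^ 2)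
  nlinarith

lemma volume_enlarged_inter_le (hR : 8 ≤ R) (hη : 0 < η) (hη8 : η ≤ 1 / 8)
    (v : EuclideanSpace ℝ (Fin 2)) :
    volume.real (closedBall v (1 + 2 * η) ∩ closedBall 0 R) ≤ inArea R v + 100 * R * η := by
  have h1 := volume_real_closedBall_diff (v := v) zero_le_one (by linarith : 1 ≤ 1 + 2 * η)
  have h2 : volume.real (closedBall v (1 + 2 * η) ∩ closedBall 0 R) ≤
      inArea R v + volume.real (closedBall v (1 + 2 * η) \ closedBall v 1) := by
    refine volume_real_le_add volume_inter_ne_top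
      (volume_ne_top_of_subset_closedBall Set.sdiff_subset) fun y hy => ?_
    by_cases h : y ∈ closedBall v 1
    · exact Or.inl ⟨h, hy.2⟩
    · exact Or.inr ⟨hy.1, h⟩
  have h3 := pi_mul_le (by nlinarith : 0 ≤ (1 + 2 * η) ^ 2 - 1 ^ 2)
  nlinarith

lemma inArea_le_volume_shrunk (hR : 8 ≤ R) (hη : 0 < η) (hη8 : η ≤ 1 / 8)
    (v : EuclideanSpace ℝ (Fin 2)) :
    inArea R v ≤ volume.real (closedBall v (1 - 2 * η) ∩ closedBall 0 (R - 2 * η)) +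
      100 * R * η := by
  have h1 := volume_real_closedBall_diff (v := v) (by linarith : 0 ≤ 1 - 2 * η)
    (by linarith : 1 - 2 * η ≤ 1)
  have h1' := volume_real_closedBall_diff (v := 0) (by linarith : 0 ≤ R - 2 * η)
    (by linarith : R - 2 * η ≤ R)
  have hf : volume (closedBall v (1 - 2 * η) ∩ closedBall 0 (R - 2 * η)) ≠ ⊤ :=
    volume_ne_top_of_subset_closedBall Set.inter_subset_left
  have hf' : volume (closedBall v 1 \ closedBall v (1 - 2 * η)) ≠ ⊤ :=
    volume_ne_top_of_subset_closedBall Set.sdiff_subset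
  have h2 : inArea R v ≤ volume.real ((closedBall v (1 - 2 * η) ∩ closedBall 0 (R - 2 * η)) ∪
      (closedBall v 1 \ closedBall v (1 - 2 * η))) +
      volume.real (closedBall 0 R \ closedBall (0 : EuclideanSpace ℝ (Fin 2)) (R - 2 * η)) := by
    refine volume_real_le_add (measure_union_lt_top hf.lt_top hf'.lt_top).ne
      (volume_ne_top_of_subset_closedBall Set.sdiff_subset) fun y hy => ?_
    by_cases h : y ∈ closedBall v (1 - 2 * η)
    · by_cases h' : y ∈ closedBall 0 (R - 2 * η)
      · exact Or.inl (Or.inl ⟨h, h'⟩)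
      · exact Or.inr ⟨hy.2, h'⟩
    · exact Or.inl (Or.inr ⟨hy.1, h⟩)
  have h2' := measureReal_union_le (μ := volume)
    (closedBall v (1 - 2 * η) ∩ closedBall 0 (R - 2 * η))
    (closedBall v 1 \ closedBall v (1 - 2 * η))
  have h3 := pi_mul_le (by nlinarith : 0 ≤ 1 ^ 2 - (1 - 2 * η) ^ 2)
  have h3' := pi_mul_le (by nlinarith : 0 ≤ R ^ 2 - (R - 2 * η) ^ 2)
  nlinarith

lemma outArea_le_volume_shrunk (hR : 8 ≤ R) (hη : 0 < η) (hη8 : η ≤ 1 / 8) (hh : 0 < h)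
    (hh1 : h ≤ 1) (v : EuclideanSpace ℝ (Fin 2)) :
    outArea (R + h) v ≤
      volume.real (closedBall v (1 - 2 * η) \ closedBall 0 (R + h + 2 * η)) + 100 * R * η := by
  have h1 := volume_real_closedBall_diff (v := v) (by linarith : 0 ≤ 1 - 2 * η)
    (by linarith : 1 - 2 * η ≤ 1)
  have h1' := volume_real_closedBall_diff (v := 0) (by linarith : 0 ≤ R + h)
    (by linarith : R + h ≤ R + h + 2 * η)
  have hf : volume (closedBall v (1 - 2 * η) \ closedBall 0 (R + h + 2 * η)) ≠ ⊤ :=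
    volume_ne_top_of_subset_closedBall Set.sdiff_subset
  have hf' : volume (closedBall v 1 \ closedBall v (1 - 2 * η)) ≠ ⊤ :=
    volume_ne_top_of_subset_closedBall Set.sdiff_subset
  have h2 : outArea (R + h) v ≤ volume.real
      ((closedBall v (1 - 2 * η) \ closedBall 0 (R + h + 2 * η)) ∪
      (closedBall v 1 \ closedBall v (1 - 2 * η))) + volume.real
      (closedBall 0 (R + h + 2 * η) \ closedBall (0 : EuclideanSpace ℝ (Fin 2)) (R + h)) := by
    refine volume_real_le_add (measure_union_lt_top hf.lt_top hf'.lt_top).ne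
      (volume_ne_top_of_subset_closedBall Set.sdiff_subset) fun y hy => ?_
    by_cases hy1 : y ∈ closedBall v (1 - 2 * η)
    · by_cases hy2 : y ∈ closedBall 0 (R + h + 2 * η)
      · exact Or.inr ⟨hy2, hy.2⟩
      · exact Or.inl (Or.inl ⟨hy1, hy2⟩)
    · exact Or.inl (Or.inr ⟨hy.1, hy1⟩)
  have h2' := measureReal_union_le (μ := volume)
    (closedBall v (1 - 2 * η) \ closedBall 0 (R + h + 2 * η))
    (closedBall v 1 \ closedBall v (1 - 2 * η))
  have h3 := pi_mul_le (by nlinarith : 0 ≤ 1 ^ 2 - (1 - 2 * η) ^ 2)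
  have h3' := pi_mul_le (by nlinarith : 0 ≤ (R + h + 2 * η) ^ 2 - (R + h) ^ 2)
  nlinarith

/-- `a` and `b` are the weighted areas across and on the own side, `a'` and `b'` their
approximations by cells. The approximation leaves `Δ/3` of the margin `Δ/2`, the terms with `ε` cost
at most `16 Δ / 104` as `a + b ≤ 16`, and `Δ/8` survives. -/
lemma balance_of_areas {a b a' b' Δ ε : ℝ} (ha : 0 ≤ a) (hb : b ≤ 8) (hab : a + Δ ≤ b)
    (hΔ : 0 < Δ) (ha' : a' ≤ a + Δ / 6) (hb' : b - Δ / 6 ≤ b') (hε : 0 ≤ ε) (hε2 : ε ≤ 1 / 2)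
    (hεΔ : ε ≤ Δ / 104) : (1 / 2 + ε) * a' + Δ / 8 ≤ (1 / 2 - ε) * b' := by
  have h1 := mul_le_mul_of_nonneg_left ha' (by linarith : 0 ≤ 1 / 2 + ε)
  have h2 := mul_le_mul_of_nonneg_left hb' (by linarith : 0 ≤ 1 / 2 - ε)
  have h3 : ε * (a + b) ≤ Δ / 104 * 16 := by
    apply mul_le_mul hεΔ <;> linarith
  linarith

/-- `F` collects the cells across the annulus that meet the unit disc around `y`, and `I` the cells
on the side of `y` that lie inside it. Cells that meet the annulus are empty, so nothing else
crosses. Each cell has area `η^2`, which turns the area margin `Δ/8` into `Δ/8/η^2`. -/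
theorem isCut_disc {N : ℕ} {Δ ε : ℝ} (hR : 8 ≤ R) (hh : 0 < h) (hh1 : h ≤ 1) (hρ : 0 ≤ ρ)
    (hρ2 : ρ ≤ 2) (hΔ : 0 < Δ)
    (hin : ∀ v : EuclideanSpace ℝ (Fin 2), 1 ≤ ‖v‖ → ‖v‖ ≤ R →
      outArea (R + h) v + Δ ≤ ρ * inArea R v)
    (hout : ∀ v : EuclideanSpace ℝ (Fin 2), R + h ≤ ‖v‖ →
      ρ * inArea R v + Δ ≤ outArea (R + h) v)
    (hη : 0 < η) (hη8 : η ≤ 1 / 8) (hηΔ : 100 * R * η ≤ Δ / 12) (hN : R + 4 < N * η)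
    (hε : 0 ≤ ε) (hε2 : ε ≤ 1 / 2) (hεΔ : ε ≤ Δ / 104) :
    IsCut N η (discDensity R h ρ η) (closedBall 0 R) ε (Δ / 8 / η ^ 2) := by
  classical
  have hη2 : 0 < η ^ 2 := by positivity
  have hrescale : ∀ F I : Finset (Fin 2 → ℤ),
      (1 / 2 + ε) * (η ^ 2 * ∑ c ∈ F, discDensity R h ρ η c) + Δ / 8 ≤
        (1 / 2 - ε) * (η ^ 2 * ∑ c ∈ I, discDensity R h ρ η c) →
      (1 / 2 + ε) * ∑ c ∈ F, discDensity R h ρ η c + Δ / 8 / η ^ 2 ≤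
        (1 / 2 - ε) * ∑ c ∈ I, discDensity R h ρ η c := by
    intro F I hFI
    refine le_of_mul_le_mul_left ?_ hη2
    calc η ^ 2 * ((1 / 2 + ε) * ∑ c ∈ F, discDensity R h ρ η c + Δ / 8 / η ^ 2)
        = (1 / 2 + ε) * (η ^ 2 * ∑ c ∈ F, discDensity R h ρ η c) + Δ / 8 := by
          field_simp
      _ ≤ _ := hFI
      _ = _ := by ring
  have hsum : ∀ (F : Finset (Fin 2 → ℤ)) (x : ℝ), (∀ c ∈ F, discDensity R h ρ η c = x) →
      η ^ 2 * ∑ c ∈ F, discDensity R h ρ η c = x * (η ^ 2 * F.card) := by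
    intro F x hF
    rw [Finset.sum_congr rfl hF, Finset.sum_const, nsmul_eq_mul]
    ring
  have hpi := Real.pi_le_four
  have hareas : ∀ v, 0 ≤ inArea R v ∧ inArea R v ≤ 4 ∧ 0 ≤ outArea (R + h) v ∧
      outArea (R + h) v ≤ 4 := by
    intro v
    have h1 := inArea_add_outArea_le (v := v) (by linarith : R ≤ R + h)
    have h2 := inArea_nonneg (R := R) (v := v)
    have h3 := outArea_nonneg (R := R + h) (v := v)
    exact ⟨h2, by linarith, h3, by linarith⟩
  have hnorm : ∀ x y : EuclideanSpace ℝ (Fin 2), dist x y ≤ 1 → ‖y‖ ≤ ‖x‖ + 1 := by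
    intro x y hxy
    rw [dist_comm, dist_eq_norm] at hxy
    linarith [norm_sub_norm_le y x]
  refine ⟨⟨cell η 0, cell_mem_window hη (by rw [norm_zero]; linarith), ?_, ?_⟩,
    ⟨cell η ((R + 3) • e₀), cell_mem_window hη (by rw [norm_smul_e₀ (by linarith)]; linarith),
      ?_, ?_⟩, fun y hy => ?_⟩
  · have h1 : ∀ x : EuclideanSpace ℝ (Fin 2), cell η x = cell η (0 : EuclideanSpace ℝ (Fin 2)) →
        ‖x‖ ≤ R - 4 := by
      intro x hx
      have := norm_le_add_of_cell_eq hη hx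
      rw [norm_zero] at this
      linarith
    rw [discDensity, if_pos fun x hx => (h1 x hx).trans (by linarith), if_pos h1]
    exact one_pos
  · intro x hx
    have := norm_le_add_of_cell_eq hη hx
    rw [norm_zero] at this
    rw [mem_closedBall_zero_iff]
    linarith
  · rw [discDensity_of_outside hη hh.le]
    · exact one_pos
    · intro x hx
      have := norm_le_add_of_cell_eq hη hx.symm
      rw [norm_smul_e₀ (by linarith)] at this
      linarith
  · intro x hx
    have := norm_le_add_of_cell_eq hη hx.symm
    rw [norm_smul_e₀ (by linarith)] at this
    rw [mem_closedBall_zero_iff]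
    linarith
  simp only [mem_closedBall_zero_iff]
  rcases le_or_gt ‖y‖ R with hyR | hyR
  -- Up to norm `R - 2` the whole unit disc is inside. Beyond it, everything in reach has norm above
  -- `R - 3`, so all cells of `I` belong to the collar of density `ρ`.
  · rcases le_or_gt ‖y‖ (R - 2) with hy2 | hy2
    · left
      intro y' _ hd
      have := hnorm y y' hd
      exact ⟨fun _ => by linarith, fun _ => hyR⟩
    right
    let F := (window 2 N).filter fun c =>
      (∀ x : EuclideanSpace ℝ (Fin 2), cell η x = c → R + h < ‖x‖) ∧ ∃ x, cell η x = c ∧ dist y x ≤ 1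
    let I := (window 2 N).filter fun c =>
      ∀ x : EuclideanSpace ℝ (Fin 2), cell η x = c → ‖x‖ ≤ R ∧ dist y x ≤ 1
    refine ⟨F, Finset.filter_subset _ _, I, Finset.filter_subset _ _, ?_, ?_, ?_⟩
    · intro y' hy' hd hne
      have h1 : R < ‖y'‖ := by
        by_contra hcon
        exact hne ⟨fun _ => not_lt.1 hcon, fun _ => hyR⟩
      have h2 := hnorm y y' hd
      refine Finset.mem_filter.2 ⟨cell_mem_window hη (by linarith), ?_, y', rfl, hd⟩
      rcases occupied_disc hη hN hy' (by linarith) with h3 | h3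
      · exact absurd (h3 y' rfl) (not_le.2 h1)
      · exact h3
    · intro y' hy'
      obtain ⟨h1, h2⟩ := (Finset.mem_filter.1 hy').2 y' rfl
      exact ⟨h2, fun _ => h1, fun _ => hyR⟩
    · apply hrescale
      have hF1 : ∀ c ∈ F, discDensity R h ρ η c = 1 := fun c hc =>
        discDensity_of_outside hη hh.le (Finset.mem_filter.1 hc).2.1
      have hI1 : ∀ c ∈ I, discDensity R h ρ η c = ρ := by
        intro c hc
        have h1 := (Finset.mem_filter.1 hc).2
        obtain ⟨x, hx⟩ := exists_cell_eq hη c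
        have h2 := hnorm x y (dist_comm y x ▸ (h1 x hx).2)
        exact discDensity_of_inside (fun x hx => (h1 x hx).1) hx (by linarith)
      rw [hsum F 1 hF1, hsum I ρ hI1, one_mul]
      have hFv : η ^ 2 * F.card ≤ outArea (R + h) y + 100 * R * η := by
        refine (pow_mul_card_le hη (T := closedBall y (1 + 2 * η) \ closedBall 0 (R + h))
          (volume_ne_top_of_subset_closedBall Set.sdiff_subset) fun x hx => ?_).trans
          (volume_enlarged_diff_le hR hη hη8 y (R + h))
        obtain ⟨h1, x', hx', hd⟩ := (Finset.mem_filter.1 hx).2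
        refine ⟨?_, ?_⟩
        · rw [mem_closedBall, dist_comm]
          have := dist_le_of_cell_eq hη hx'
          linarith [dist_triangle y x' x]
        · rw [mem_closedBall_zero_iff, not_le]
          exact h1 x rfl
      have hIv : inArea R y ≤ η ^ 2 * I.card + 100 * R * η := by
        refine (inArea_le_volume_shrunk hR hη hη8 y).trans (add_le_add_left ?_ _)
        refine le_pow_mul_card hη fun x hx => ?_
        obtain ⟨h1, h2⟩ := hx
        rw [mem_closedBall, dist_comm] at h1
        rw [mem_closedBall_zero_iff] at h2
        refine Finset.mem_filter.2 ⟨cell_mem_window hη (by linarith), fun x' hx' => ⟨?_, ?_⟩⟩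
        · linarith [norm_le_add_of_cell_eq hη hx']
        · have := dist_le_of_cell_eq hη hx'.symm
          linarith [dist_triangle y x x']
      obtain ⟨h1, h2, h3, h4⟩ := hareas y
      refine balance_of_areas h3 (b := ρ * inArea R y) (by nlinarith)
        (hin y (by linarith) hyR) hΔ (by linarith) ?_ hε hε2 hεΔ
      have h5 := mul_le_mul_of_nonneg_left hIv hρ
      have h6 : ρ * (100 * R * η) ≤ 2 * (Δ / 12) := by
        apply mul_le_mul hρ2 hηΔ (by positivity) (by norm_num)
      linarith
  · rcases lt_or_ge (R + 2) ‖y‖ with hy2 | hy2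
    · left
      intro y' _ hd
      have := hnorm y' y (dist_comm y y' ▸ hd)
      exact ⟨fun h => by linarith, fun h => by linarith⟩
    have hyR' : R + h < ‖y‖ := by
      rcases occupied_disc hη hN hy (by linarith) with h3 | h3
      · exact absurd (h3 y rfl) (not_le.2 hyR)
      · exact h3 y rfl
    right
    let F := (window 2 N).filter fun c =>
      (∀ x : EuclideanSpace ℝ (Fin 2), cell η x = c → ‖x‖ ≤ R) ∧ ∃ x, cell η x = c ∧ dist y x ≤ 1
    let I := (window 2 N).filter fun c =>
      ∀ x : EuclideanSpace ℝ (Fin 2), cell η x = c → R + h < ‖x‖ ∧ dist y x ≤ 1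
    refine ⟨F, Finset.filter_subset _ _, I, Finset.filter_subset _ _, ?_, ?_, ?_⟩
    · intro y' hy' hd hne
      have h1 : ‖y'‖ ≤ R := by
        by_contra hcon
        exact hne ⟨fun h => absurd h (not_le.2 hyR), fun h => absurd h hcon⟩
      refine Finset.mem_filter.2 ⟨cell_mem_window hη (by linarith), ?_, y', rfl, hd⟩
      rcases occupied_disc hη hN hy' (by linarith) with h3 | h3
      · exact h3
      · linarith [h3 y' rfl]
    · intro y' hy'
      obtain ⟨h1, h2⟩ := (Finset.mem_filter.1 hy').2 y' rfl
      exact ⟨h2, fun h => by linarith, fun h => by linarith⟩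
    · apply hrescale
      have hF1 : ∀ c ∈ F, discDensity R h ρ η c = ρ := by
        intro c hc
        obtain ⟨h1, x, hx, hd⟩ := (Finset.mem_filter.1 hc).2
        have h2 := hnorm x y (dist_comm y x ▸ hd)
        exact discDensity_of_inside h1 hx (by linarith)
      have hI1 : ∀ c ∈ I, discDensity R h ρ η c = 1 := fun c hc =>
        discDensity_of_outside hη hh.le fun x hx => ((Finset.mem_filter.1 hc).2 x hx).1
      rw [hsum F ρ hF1, hsum I 1 hI1, one_mul]
      have hFv : η ^ 2 * F.card ≤ inArea R y + 100 * R * η := by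
        refine (pow_mul_card_le hη (T := closedBall y (1 + 2 * η) ∩ closedBall 0 R)
          (volume_ne_top_of_subset_closedBall Set.inter_subset_left) fun x hx => ?_).trans
          (volume_enlarged_inter_le hR hη hη8 y)
        obtain ⟨h1, x', hx', hd⟩ := (Finset.mem_filter.1 hx).2
        refine ⟨?_, ?_⟩
        · rw [mem_closedBall, dist_comm]
          have := dist_le_of_cell_eq hη hx'
          linarith [dist_triangle y x' x]
        · rw [mem_closedBall_zero_iff]
          exact h1 x rfl
      have hIv : outArea (R + h) y ≤ η ^ 2 * I.card + 100 * R * η := by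
        refine (outArea_le_volume_shrunk hR hη hη8 hh hh1 y).trans (add_le_add_left ?_ _)
        refine le_pow_mul_card hη fun x hx => ?_
        obtain ⟨h1, h2⟩ := hx
        rw [mem_closedBall, dist_comm] at h1
        rw [mem_closedBall_zero_iff, not_le] at h2
        have h3 := hnorm y x (by linarith)
        refine Finset.mem_filter.2 ⟨cell_mem_window hη (by linarith), fun x' hx' => ⟨?_, ?_⟩⟩
        · linarith [norm_le_add_of_cell_eq hη hx'.symm]
        · have := dist_le_of_cell_eq hη hx'.symm
          linarith [dist_triangle y x x']
      obtain ⟨h1, h2, h3, h4⟩ := hareas y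
      refine balance_of_areas (mul_nonneg hρ h1) (b := outArea (R + h) y) (by linarith)
        (hout y hyR'.le) hΔ ?_ (by linarith) hε hε2 hεΔ
      have h5 := mul_le_mul_of_nonneg_left hFv hρ
      have h6 : ρ * (100 * R * η) ≤ 2 * (Δ / 12) := by
        apply mul_le_mul hρ2 hηΔ (by positivity) (by norm_num)
      linarith

/-- Only two kinds of cells deviate from density `1`. Those of the collar, contained in `B`, have
total area `O(R)` and squared deviation at most `64 / R^2`. The empty ones, contained in `Z`, have
total area `O((h + η) R)` with `h, η ≤ 1 / R^2`. Both contribute `O(1 / R)`. -/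
lemma cost_disc_le {N : ℕ} (hR : 8 ≤ R) (hh : 0 < h) (hhR : h ≤ 1 / R ^ 2) (hη : 0 < η)
    (hηR : η ≤ 1 / R ^ 2) (hρ : |ρ - 1| ≤ 8 / R) :
    η ^ 2 * ∑ c ∈ window 2 N, (discDensity R h ρ η c - 1) ^ 2 ≤ 3000 / R := by
  classical
  have hR0 : 0 < R := by linarith
  have hR2 : 1 / R ^ 2 ≤ 1 / 64 := one_div_le_one_div_of_le (by norm_num) (by nlinarith)
  let B := (window 2 N).filter fun c =>
    ∀ x : EuclideanSpace ℝ (Fin 2), cell η x = c → ‖x‖ ≤ R ∧ R - 4 - 2 * η < ‖x‖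
  let Z := (window 2 N).filter fun c =>
    ∀ x : EuclideanSpace ℝ (Fin 2), cell η x = c → ‖x‖ ≤ R + h + 2 * η ∧ R - 2 * η < ‖x‖
  have hterm : ∀ c ∈ window 2 N, (discDensity R h ρ η c - 1) ^ 2 ≤
      (if c ∈ B then (ρ - 1) ^ 2 else 0) + (if c ∈ Z then 1 else 0) := by
    intro c hc
    have hB0 : 0 ≤ (if c ∈ B then (ρ - 1) ^ 2 else 0) := by split_ifs <;> positivity
    have hZ0 : (0 : ℝ) ≤ (if c ∈ Z then 1 else 0) := by split_ifs <;> norm_num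
    by_cases h1 : ∀ y : EuclideanSpace ℝ (Fin 2), cell η y = c → ‖y‖ ≤ R
    · by_cases h2 : ∀ y : EuclideanSpace ℝ (Fin 2), cell η y = c → ‖y‖ ≤ R - 4
      · rw [discDensity, if_pos h1, if_pos h2]
        linarith
      · have hcB : c ∈ B := by
          push Not at h2
          obtain ⟨y, hy, hyR⟩ := h2
          refine Finset.mem_filter.2 ⟨hc, fun x hx => ⟨h1 x hx, ?_⟩⟩
          linarith [norm_le_add_of_cell_eq hη (hy.trans hx.symm)]
        rw [discDensity, if_pos h1, if_neg h2, if_pos hcB]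
        linarith
    · by_cases h2 : ∀ y : EuclideanSpace ℝ (Fin 2), cell η y = c → R + h < ‖y‖
      · rw [discDensity, if_neg h1, if_pos h2]
        linarith
      · have hcZ : c ∈ Z := by
          push Not at h1 h2
          obtain ⟨y, hy, hyR⟩ := h1
          obtain ⟨y', hy', hyR'⟩ := h2
          refine Finset.mem_filter.2 ⟨hc, fun x hx => ⟨?_, ?_⟩⟩
          · linarith [norm_le_add_of_cell_eq hη (hx.trans hy'.symm)]
          · linarith [norm_le_add_of_cell_eq hη (hy.trans hx.symm)]
        rw [discDensity, if_neg h1, if_neg h2, if_pos hcZ]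
        linarith
  have hBv : η ^ 2 * B.card ≤ 40 * R := by
    have h1 := volume_real_closedBall_diff (v := 0) (by linarith : 0 ≤ R - 4 - 2 * η)
      (by linarith : R - 4 - 2 * η ≤ R)
    have h2 := pow_mul_card_le hη (F := B)
      (T := closedBall (0 : EuclideanSpace ℝ (Fin 2)) R \ closedBall 0 (R - 4 - 2 * η))
      (volume_ne_top_of_subset_closedBall Set.sdiff_subset) fun x hx => by
        obtain ⟨h3, h4⟩ := (Finset.mem_filter.1 hx).2 x rfl
        exact ⟨by simpa using h3, by simpa using h4⟩
    have h3 := pi_mul_le (by nlinarith : 0 ≤ R ^ 2 - (R - 4 - 2 * η) ^ 2)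
    nlinarith
  have hZv : η ^ 2 * Z.card ≤ 4 * ((h + 4 * η) * (3 * R)) := by
    have h1 := volume_real_closedBall_diff (v := 0) (by linarith : 0 ≤ R - 2 * η)
      (by linarith : R - 2 * η ≤ R + h + 2 * η)
    have h2 := pow_mul_card_le hη (F := Z)
      (T := closedBall (0 : EuclideanSpace ℝ (Fin 2)) (R + h + 2 * η) \ closedBall 0 (R - 2 * η))
      (volume_ne_top_of_subset_closedBall Set.sdiff_subset) fun x hx => by
        obtain ⟨h3, h4⟩ := (Finset.mem_filter.1 hx).2 x rfl
        exact ⟨by simpa using h3, by simpa using h4⟩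
    have h3 := pi_mul_le (by nlinarith : 0 ≤ (R + h + 2 * η) ^ 2 - (R - 2 * η) ^ 2)
    have h4 : (R + h + 2 * η) ^ 2 - (R - 2 * η) ^ 2 = (h + 4 * η) * (2 * R + h) := by ring
    have h5 : (h + 4 * η) * (2 * R + h) ≤ (h + 4 * η) * (3 * R) := by
      gcongr
      linarith
    rw [h4] at h3 h1
    linarith
  have hρsq : (ρ - 1) ^ 2 ≤ 64 / R ^ 2 := by
    rw [← sq_abs]
    calc |ρ - 1| ^ 2 ≤ (8 / R) ^ 2 := by gcongr
      _ = _ := by rw [div_pow]; norm_num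
  have hB2 : B.card = ((window 2 N).filter fun c => c ∈ B).card := by
    congr 1
    ext c
    simp [B]
  have hZ2 : Z.card = ((window 2 N).filter fun c => c ∈ Z).card := by
    congr 1
    ext c
    simp [Z]
  calc η ^ 2 * ∑ c ∈ window 2 N, (discDensity R h ρ η c - 1) ^ 2
      ≤ η ^ 2 * ∑ c ∈ window 2 N,
        ((if c ∈ B then (ρ - 1) ^ 2 else 0) + (if c ∈ Z then 1 else 0)) := by
        gcongr with c hc
        exact hterm c hc
    _ = (ρ - 1) ^ 2 * (η ^ 2 * B.card) + η ^ 2 * Z.card := by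
        rw [Finset.sum_add_distrib, ← Finset.sum_filter, ← Finset.sum_filter, Finset.sum_const,
          Finset.sum_const, nsmul_eq_mul, nsmul_eq_mul, ← hB2, ← hZ2]
        ring
    _ ≤ 64 / R ^ 2 * (40 * R) + 4 * ((1 / R ^ 2 + 4 * (1 / R ^ 2)) * (3 * R)) := by
        refine add_le_add (mul_le_mul hρsq hBv (by positivity) (by positivity)) (hZv.trans ?_)
        gcongr
    _ = 2620 / R := by
        field_simp
        norm_num
    _ ≤ 3000 / R := by
        gcongr
        norm_num

end Disc

/-! ### The planar statement. -/

/-- The part of the planar statement above the connectivity threshold. -/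
theorem exists_aas_disc {C : ℝ} (hC : 1 ≤ C) : ∃ ε : ℝ, 0 < ε ∧ ε ≤ 1 / 2 ∧ ∀ r : ℕ → ℝ,
    (∀ᶠ n : ℕ in atTop, 1 / 10 * Real.sqrt (Real.log n / n) ≤ r n ∧
      r n ≤ C * Real.sqrt (Real.log n / n)) →
    AAS 2 r fun _ G => ∃ H, IsAlphaSubgraph (1 / 2 + ε) H G ∧ ¬ H.Connected := by
  -- Chosen so that the cost `3000 / R * (C^2 * log n)` is exactly `log n / 2`.
  set R : ℝ := 6000 * C ^ 2 with hRdef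
  have hR : 8 ≤ R := by nlinarith
  have hR0 : 0 < R := by linarith
  have hR2 : 1 / R ^ 2 ≤ 1 / 64 := one_div_le_one_div_of_le (by norm_num) (by nlinarith)
  set h : ℝ := 1 / R ^ 2 with hhdef
  have hh : 0 < h := by positivity
  have hhR : h ≤ 1 / R := one_div_le_one_div_of_le hR0 (by nlinarith)
  obtain ⟨ρ, hρ, Δ, hΔ, hin, hout⟩ := exists_balancing_density hR hh hhR
  have h8 : 8 / R ≤ 1 := by rwa [div_le_one hR0]
  obtain ⟨hρ1, hρ2⟩ := abs_le.1 hρ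
  -- The first bound keeps the empty cells cheap. The second makes the cell error `100 R η` at most
  -- `Δ/12`, so that it stays within the `Δ/6` of `balance_of_areas` after multiplication by `ρ ≤
  -- 2`.
  set η : ℝ := min (1 / R ^ 2) (Δ / (1200 * R)) with hηdef
  have hη : 0 < η := lt_min hh (by positivity)
  have hηR : η ≤ 1 / R ^ 2 := min_le_left _ _
  have hηΔ : 100 * R * η ≤ Δ / 12 := by
    have h1 : η ≤ Δ / (1200 * R) := min_le_right _ _
    calc 100 * R * η ≤ 100 * R * (Δ / (1200 * R)) := by gcongr
      _ = Δ / 12 := by field_simp; norm_num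
  obtain ⟨N, hN⟩ := exists_nat_gt ((R + 4) / η)
  rw [div_lt_iff₀ hη] at hN
  have hN0 : N ≠ 0 := by
    rintro rfl
    simp only [Nat.cast_zero, zero_mul] at hN
    linarith
  set ε : ℝ := min (Δ / 104) (1 / 2) with hεdef
  have hε : 0 < ε := lt_min (by positivity) (by norm_num)
  have hε2 : ε ≤ 1 / 2 := min_le_right _ _
  refine ⟨ε, hε, hε2, fun r hr => ?_⟩
  have hlog : Tendsto (fun n : ℕ => Real.log n) atTop atTop :=
    Real.tendsto_log_atTop.comp tendsto_natCast_atTop_atTop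
  refine aas_of_isCut two_ne_zero hN0 hη (discDensity_nonneg (by linarith))
    (discDensity_le_two (by linarith)) hε.le hε2 (θ := Δ / 8 / η ^ 2) (by positivity)
    (isCut_disc hR hh (by linarith) (by linarith) (by linarith) hΔ hin hout hη
      (by linarith) hηΔ hN hε.le hε2 (min_le_left _ _))
    (c₀ := 1 / 100) (C₀ := C ^ 2) (δ := 1 / 2) (by norm_num) (by positivity) (by norm_num) ?_
  filter_upwards [hr, hlog.eventually_ge_atTop 1, eventually_ge_atTop 1] with n hrn hL hn
  have hn0 : (0 : ℝ) < n := by exact_mod_cast hn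
  obtain ⟨h1, h2⟩ := hrn
  have hr0 : 0 < r n := lt_of_lt_of_le (by positivity) h1
  have hsq : ∀ x : ℝ, n * (x * Real.sqrt (Real.log n / n)) ^ 2 = x ^ 2 * Real.log n := by
    intro x
    rw [mul_pow, Real.sq_sqrt (by positivity)]
    field_simp
  have hup : n * r n ^ 2 ≤ C ^ 2 * Real.log n := by
    rw [← hsq]
    gcongr
  refine ⟨hr0, ?_, hup, ?_⟩
  · have h3 : (1 / 100 : ℝ) = (1 / 10) ^ 2 := by norm_num
    rw [h3, ← hsq]
    gcongr
  · have hcost := cost_disc_le (N := N) hR hh le_rfl hη hηR hρ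
    calc _ ≤ 3000 / R * (C ^ 2 * Real.log n) := by gcongr
      _ = (1 - 1 / 2) * Real.log n := by
        rw [hRdef]
        field_simp
        norm_num

/-- Enlarging `C` to at least `1` lets the bound also cover the reference radius, whose constant is
`1/10`. -/
theorem exists_aas_plane_of_le {C : ℝ} : ∃ ε : ℝ, 0 < ε ∧ ε ≤ 1 / 2 ∧ ∀ r : ℕ → ℝ,
    (∀ᶠ n : ℕ in atTop, 0 < r n ∧ r n ≤ C * Real.sqrt (Real.log n / n)) →
    AAS 2 r fun _ G => ∃ H, IsAlphaSubgraph (1 / 2 + ε) H G ∧ ¬ H.Connected := by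
  obtain ⟨ε, hε, hε2, h⟩ := exists_aas_disc (le_max_right C 1)
  refine ⟨ε, hε, hε2, fun r hr => aas_of_aas_max hε2 (h _ ?_) aas_isolated⟩
  filter_upwards [hr] with n hrn
  refine ⟨le_max_right _ _, max_le (hrn.2.trans ?_) ?_⟩
  · gcongr
    exact le_max_left _ _
  · gcongr
    exact le_trans (by norm_num) (le_max_right C 1)

end RGG

theorem theorem1p5 :
    (∀ ε : ℝ, 0 < ε → ε ≤ 1 / 2 → ∀ r : ℕ → ℝ,
      (∀ᶠ n : ℕ in atTop, 0 < r n ∧ r n ≤ Real.log n / (4 * ε * n)) →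
      RGG.AAS 1 r fun _ G =>
        ∃ H, RGG.IsAlphaSubgraph (1 / 2 + ε) H G ∧ ¬ H.Connected) ∧
    (∀ C : ℝ, 0 < C → ∃ ε : ℝ, 0 < ε ∧ ε ≤ 1 / 2 ∧ ∀ r : ℕ → ℝ,
      (∀ᶠ n : ℕ in atTop, 0 < r n ∧ r n ≤ C * Real.sqrt (Real.log n / n)) →
      RGG.AAS 2 r fun _ G =>
        ∃ H, RGG.IsAlphaSubgraph (1 / 2 + ε) H G ∧ ¬ H.Connected) :=
  ⟨fun _ hε hε2 _ hr => RGG.aas_line_of_le hε hε2 hr, fun _ _ => RGG.exists_aas_plane_of_le⟩
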